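/- Let $T$ be the unilateral shift $Te_n=e_{n+1}$ on $\ell^2(\mathbb Z_+)$, let $\mathcal T\subset B(\ell^2(\mathbb Z_+))$ be the Toeplitz algebra, i.e. the norm-closed $*$-algebra generated by $T$, put $T_{n,m}=T^nT^{*m}$, and let $\mathcal K\subset\mathcal T$ be the compact operators. Let $\Delta:\mathcal T\to\mathcal T\otimes\mathcal T$ (minimal $C^*$-tensor product) be the unique unital $*$-homomorphism with $\Delta(T)=T\otimes T$, and for $\rho,\varphi$ in the dual space $\mathcal T^*$ put $(\rho\ast\varphi)(A)=(\rho\otimes\varphi)(\Delta(A))$, where $\rho\otimes\varphi$ is the bounded functional on $\mathcal T\otimes\mathcal T$ with $(\rho\otimes\varphi)(A\otimes B)=\rho(A)\varphi(B)$. Then the annihilator $\mathcal K^\perp=\{\rho\in\mathcal T^*:\rho|_{\mathcal K}=0\}$ is a linear subspace of $\mathcal T^*$ closed under $\ast$ (a subalgebra), and the following hold. 1. The map $\pi_1^*:(\mathcal T/\mathcal K)^*\to\mathcal K^\perp$, $\pi_1^*(\varphi)(A)=\varphi([A])$, is an isometric linear bijection. 2. There is an isometric $*$-isomorphism $\pi_2:\mathcal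 T/\mathcal K\to C(S^1)$ with $\pi_2([T_{n,m}])(z)=z^{m-n}$. Let $M(S^1)$ be the space of regular complex Borel measures on the circle with the total variation norm. The map $\mu\mapsto\bigl(x\mapsto\int_{S^1}\pi_2(x)\,d\mu\bigr)$ is an isometric linear bijection $M(S^1)\to(\mathcal T/\mathcal K)^*$. 3. The composed isometric linear bijection $\Phi:M(S^1)\to\mathcal K^\perp$, $\Phi(\mu)(A)=\int_{S^1}\pi_2([A])\,d\mu$, carries convolution of measures (the image of $\mu\times\nu$ under $(z,w)\mapsto zw$) to the product $\ast$: $\Phi(\mu\ast\nu)=\Phi(\mu)\ast\Phi(\nu)$ for all $\mu,\nu\in M(S^1)$. -/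

import Mathlib

noncomputable section

open MeasureTheory UniformSpace
open scoped TensorProduct ENNReal InnerProductSpace

namespace ToeplitzQuantumSemigroup

/-! ### The Toeplitz algebra -/

/-- The Hilbert space `ℓ²(ℤ₊)`. -/
abbrev Ell2 : Type := lp (fun _ : ℕ => ℂ) 2

/-- The unilateral shift `(T f) 0 = 0`, `(T f) (n + 1) = f n`, that is `T eₙ = eₙ₊₁`. -/
def shiftIsometry : Ell2 →ₗᵢ[ℂ] Ell2 where
  toFun f := ⟨fun n => Nat.casesOn n 0 (fun k => f k), by
    apply memℓp_gen
    rw [← summable_nat_add_iff 1]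
    exact (lp.memℓp f).summable (by norm_num)⟩
  map_add' f g := by
    ext n
    cases n with
    | zero => exact (add_zero (0 : ℂ)).symm
    | succ n => rfl
  map_smul' c f := by
    ext n
    cases n <;> simp
  norm_map' f := by
    have h2 : (0 : ℝ) < (2 : ℝ≥0∞).toReal := by norm_num
    rw [lp.norm_eq_tsum_rpow h2, lp.norm_eq_tsum_rpow h2]
    congr 1
    rw [Summable.tsum_eq_zero_add]
    · simp
    · rw [← summable_nat_add_iff 1]
      exact (lp.memℓp f).summable h2

/-- The unilateral shift as a bounded operator. -/
def shift : Ell2 →L[ℂ] Ell2 := shiftIsometry.toContinuousLinearMap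

/-- The operator `T_{n,m} = Tⁿ T*ᵐ`. -/
def monomial (n m : ℕ) : Ell2 →L[ℂ] Ell2 := shift ^ n * (star shift) ^ m

/-- The Toeplitz algebra: the norm closed *-subalgebra of `B(ℓ²(ℤ₊))` generated by the shift. -/
def toeplitz : StarSubalgebra ℂ (Ell2 →L[ℂ] Ell2) := StarAlgebra.elemental ℂ shift

theorem isClosed_toeplitz : IsClosed (toeplitz : Set (Ell2 →L[ℂ] Ell2)) :=
  StarAlgebra.elemental.isClosed ℂ shift

theorem shift_mem : shift ∈ toeplitz := StarAlgebra.elemental.self_mem ℂ shift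

theorem monomial_mem (n m : ℕ) : monomial n m ∈ toeplitz :=
  mul_mem (pow_mem shift_mem n) (pow_mem (star_mem shift_mem) m)

/-! ### Hilbert space tensor products and spatial tensor products of operator algebras -/

section Tensor

variable {H K : Type*} [NormedAddCommGroup H] [InnerProductSpace ℂ H]
  [NormedAddCommGroup K] [InnerProductSpace ℂ K]

/-- The Hilbert space tensor product: the completion of the algebraic tensor product for
`⟪x ⊗ y, x' ⊗ y'⟫ = ⟪x, x'⟫ ⟪y, y'⟫`. -/
def HilbertTensor (H K : Type*) [NormedAddCommGroup H] [InnerProductSpace ℂ H]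
    [NormedAddCommGroup K] [InnerProductSpace ℂ K] : Type _ :=
  Completion (H ⊗[ℂ] K)

instance : NormedAddCommGroup (HilbertTensor H K) :=
  inferInstanceAs (NormedAddCommGroup (Completion (H ⊗[ℂ] K)))

instance : InnerProductSpace ℂ (HilbertTensor H K) :=
  inferInstanceAs (InnerProductSpace ℂ (Completion (H ⊗[ℂ] K)))

instance : CompleteSpace (HilbertTensor H K) :=
  inferInstanceAs (CompleteSpace (Completion (H ⊗[ℂ] K)))

/-- The isometric embedding of the algebraic tensor product. -/
def embed : (H ⊗[ℂ] K) →ₗᵢ[ℂ] HilbertTensor H K :=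
  (Completion.toComplₗᵢ : (H ⊗[ℂ] K) →ₗᵢ[ℂ] Completion (H ⊗[ℂ] K))

theorem denseRange_embed : DenseRange (embed : (H ⊗[ℂ] K) → HilbertTensor H K) :=
  Completion.denseRange_coe

/-- The elementary tensor `x ⊗ y` in the Hilbert space tensor product. -/
def tmul (x : H) (y : K) : HilbertTensor H K := embed (x ⊗ₜ[ℂ] y)

/-- The bounded operator `a ⊗ b`, determined by `(a ⊗ b) (x ⊗ y) = a x ⊗ b y`. -/
def tensorOp (a : H →L[ℂ] H) (b : K →L[ℂ] K) : HilbertTensor H K →L[ℂ] HilbertTensor H K :=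
  (TensorProduct.mapL a b).completion

theorem tensorOp_tmul (a : H →L[ℂ] H) (b : K →L[ℂ] K) (x : H) (y : K) :
    tensorOp a b (tmul x y) = tmul (a x) (b y) :=
  (TensorProduct.mapL a b).completion_apply_coe (x ⊗ₜ[ℂ] y)

theorem inner_tmul_tmul (x x' : H) (y y' : K) :
    inner ℂ (tmul x y) (tmul x' y') = inner ℂ x x' * inner ℂ y y' := by
  rw [tmul, tmul, LinearIsometry.inner_map_map, TensorProduct.inner_tmul]

theorem op_ext {F : Type*} [NormedAddCommGroup F] [NormedSpace ℂ F]
    {f g : HilbertTensor H K →L[ℂ] F} (h : ∀ x y, f (tmul x y) = g (tmul x y)) : f = g := by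
  ext z
  induction z using denseRange_embed.induction_on with
  | hp => exact isClosed_eq f.continuous g.continuous
  | ih z =>
    induction z with
    | zero => simp
    | tmul x y => exact h x y
    | add z w hz hw => simp only [map_add, hz, hw]

theorem tensorOp_one : tensorOp (1 : H →L[ℂ] H) (1 : K →L[ℂ] K) = 1 :=
  op_ext fun x y => by simp [tensorOp_tmul]

theorem tensorOp_mul (a a' : H →L[ℂ] H) (b b' : K →L[ℂ] K) :
    tensorOp (a * a') (b * b') = tensorOp a b * tensorOp a' b' :=
  op_ext fun x y => by simp [tensorOp_tmul]

theorem tmul_add_left (x x' : H) (y : K) : tmul (x + x') y = tmul x y + tmul x' y := by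
  simp [tmul, TensorProduct.add_tmul]

theorem tmul_smul_left (c : ℂ) (x : H) (y : K) : tmul (c • x) y = c • tmul x y := by
  simp [tmul, ← TensorProduct.smul_tmul']

theorem tmul_add_right (x : H) (y y' : K) : tmul x (y + y') = tmul x y + tmul x y' := by
  simp [tmul, TensorProduct.tmul_add]

theorem tmul_smul_right (c : ℂ) (x : H) (y : K) : tmul x (c • y) = c • tmul x y := by
  simp [tmul]

theorem tensorOp_star [CompleteSpace H] [CompleteSpace K] (a : H →L[ℂ] H) (b : K →L[ℂ] K) :
    star (tensorOp a b) = tensorOp (star a) (star b) := by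
  symm
  simp only [ContinuousLinearMap.star_eq_adjoint]
  rw [ContinuousLinearMap.eq_adjoint_iff]
  intro z w
  induction z using denseRange_embed.induction_on with
  | hp => exact isClosed_eq (by fun_prop) (by fun_prop)
  | ih z =>
    induction w using denseRange_embed.induction_on with
    | hp => exact isClosed_eq (by fun_prop) (by fun_prop)
    | ih w =>
      induction z with
      | zero => simp
      | add z z' hz hz' => simp only [map_add, inner_add_left, hz, hz']
      | tmul x y =>
        induction w with
        | zero => simp
        | add w w' hz hz' => simp only [map_add, inner_add_right, hz, hz']
        | tmul x' y' =>
          change inner ℂ (tensorOp _ _ (tmul x y)) (tmul x' y')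
            = inner ℂ (tmul x y) (tensorOp _ _ (tmul x' y'))
          simp only [tensorOp_tmul, inner_tmul_tmul, ContinuousLinearMap.adjoint_inner_left]

/-- `x ↦ x ⊗ y` as a bounded operator. -/
def tmulRight (y : K) : H →L[ℂ] HilbertTensor H K :=
  LinearMap.mkContinuous
    { toFun := fun x => tmul x y
      map_add' := fun x x' => tmul_add_left x x' y
      map_smul' := fun c x => tmul_smul_left c x y } ‖y‖ (fun x => by
        simp [tmul, mul_comm])

theorem norm_tmulRight_le (y : K) : ‖(tmulRight y : H →L[ℂ] HilbertTensor H K)‖ ≤ ‖y‖ :=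
  LinearMap.mkContinuous_norm_le _ (norm_nonneg _) _

theorem tmulRight_add (y y' : K) :
    (tmulRight (y + y') : H →L[ℂ] HilbertTensor H K) = tmulRight y + tmulRight y' := by
  ext x
  exact tmul_add_right x y y'

theorem tmulRight_smul (c : ℂ) (y : K) :
    (tmulRight (c • y) : H →L[ℂ] HilbertTensor H K) = c • tmulRight y := by
  ext x
  exact tmul_smul_right c x y

/-- The minimal (spatial) C*-tensor product of two operator algebras: the norm closed *-subalgebra
of `B(H ⊗ K)` generated by the elementary tensors. -/
def spatialTensor [CompleteSpace H] [CompleteSpace K] (A : StarSubalgebra ℂ (H →L[ℂ] H))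
    (B : StarSubalgebra ℂ (K →L[ℂ] K)) :
    StarSubalgebra ℂ (HilbertTensor H K →L[ℂ] HilbertTensor H K) :=
  (StarAlgebra.adjoin ℂ {x | ∃ a ∈ A, ∃ b ∈ B, x = tensorOp a b}).topologicalClosure

variable [CompleteSpace H] [CompleteSpace K] {A : StarSubalgebra ℂ (H →L[ℂ] H)}
  {B : StarSubalgebra ℂ (K →L[ℂ] K)}

theorem tensorOp_mem {a : H →L[ℂ] H} {b : K →L[ℂ] K} (ha : a ∈ A) (hb : b ∈ B) :
    tensorOp a b ∈ spatialTensor A B :=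
  StarSubalgebra.le_topologicalClosure _ (StarAlgebra.subset_adjoin ℂ _ ⟨a, ha, b, hb, rfl⟩)

/-- The elementary tensor `a ⊗ b` as an element of the spatial tensor product. -/
def elemTensor (a : A) (b : B) : spatialTensor A B :=
  ⟨tensorOp (a : H →L[ℂ] H) (b : K →L[ℂ] K), tensorOp_mem a.2 b.2⟩

/-- Elementary tensors span a dense subspace of the spatial tensor product. -/
theorem spatialTensor_eq_closure :
    (spatialTensor A B : Set (HilbertTensor H K →L[ℂ] HilbertTensor H K)) =
      closure (Submodule.span ℂ {x | ∃ a ∈ A, ∃ b ∈ B, x = tensorOp a b} :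
        Set (HilbertTensor H K →L[ℂ] HilbertTensor H K)) := by
  rw [spatialTensor, StarSubalgebra.topologicalClosure_coe]
  congr 1
  have key : ((Submonoid.closure ({x | ∃ a ∈ A, ∃ b ∈ B, x = tensorOp a b} ∪
      star {x | ∃ a ∈ A, ∃ b ∈ B, x = tensorOp a b}) : Submonoid _) :
        Set (HilbertTensor H K →L[ℂ] HilbertTensor H K)) =
      {x | ∃ a ∈ A, ∃ b ∈ B, x = tensorOp a b} := by
    apply Set.Subset.antisymm
    · intro x hx
      induction hx using Submonoid.closure_induction with
      | mem x hx =>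
        rcases hx with hx | hx
        · exact hx
        · obtain ⟨a, ha, b, hb, h⟩ := hx
          exact ⟨star a, star_mem ha, star b, star_mem hb, by
            rw [← tensorOp_star, ← h, star_star]⟩
      | one => exact ⟨1, one_mem A, 1, one_mem B, tensorOp_one.symm⟩
      | mul x y _ _ hx hy =>
        obtain ⟨a, ha, b, hb, rfl⟩ := hx
        obtain ⟨a', ha', b', hb', rfl⟩ := hy
        exact ⟨a * a', mul_mem ha ha', b * b', mul_mem hb hb', (tensorOp_mul _ _ _ _).symm⟩
    · exact fun x hx => Submonoid.subset_closure (Or.inl hx)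
  have := StarAlgebra.adjoin_eq_span (R := ℂ)
    {x : HilbertTensor H K →L[ℂ] HilbertTensor H K | ∃ a ∈ A, ∃ b ∈ B, x = tensorOp a b}
  rw [key] at this
  exact congrArg (fun S : Submodule ℂ (HilbertTensor H K →L[ℂ] HilbertTensor H K) =>
    (S : Set (HilbertTensor H K →L[ℂ] HilbertTensor H K))) this

/-- The compression of an operator on `H ⊗ K` to `H` by two vectors of `K`. -/
def compress (x : HilbertTensor H K →L[ℂ] HilbertTensor H K) (y y' : K) : H →L[ℂ] H :=
  (ContinuousLinearMap.adjoint (tmulRight y)) ∘L x ∘L (tmulRight y')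

theorem norm_compress_le (x : HilbertTensor H K →L[ℂ] HilbertTensor H K) (y y' : K) :
    ‖compress x y y'‖ ≤ ‖x‖ * ‖y‖ * ‖y'‖ := by
  have h1 := norm_tmulRight_le (H := H) y
  have h2 := norm_tmulRight_le (H := H) y'
  calc ‖compress x y y'‖ ≤ ‖ContinuousLinearMap.adjoint (tmulRight (H := H) y)‖ *
        (‖x‖ * ‖tmulRight (H := H) y'‖) :=
        (ContinuousLinearMap.opNorm_comp_le _ _).trans
          (mul_le_mul_of_nonneg_left (ContinuousLinearMap.opNorm_comp_le _ _) (norm_nonneg _))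
    _ ≤ ‖y‖ * (‖x‖ * ‖y'‖) := by
        rw [LinearIsometryEquiv.norm_map]
        gcongr
    _ = ‖x‖ * ‖y‖ * ‖y'‖ := by ring

theorem compress_tensorOp (a : H →L[ℂ] H) (b : K →L[ℂ] K) (y y' : K) :
    compress (tensorOp a b) y y' = (inner ℂ y (b y')) • a := by
  ext x
  apply ext_inner_left ℂ
  intro v
  change inner ℂ v (ContinuousLinearMap.adjoint (tmulRight y) (tensorOp a b (tmul x y'))) = _
  rw [ContinuousLinearMap.adjoint_inner_right, tensorOp_tmul]
  change inner ℂ (tmul v y) _ = _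
  rw [inner_tmul_tmul]
  simp [inner_smul_right, mul_comm]

/-- The slice map `ρ ⊗ id : B(H ⊗ K) → B(K)`, `⟪y, (ρ ⊗ id)(x) y'⟫ = ρ (V_y* x V_y')`. -/
theorem exists_slice (ρ : StrongDual ℂ (H →L[ℂ] H)) :
    ∃ R : (HilbertTensor H K →L[ℂ] HilbertTensor H K) →L[ℂ] (K →L[ℂ] K),
      ∀ a b, R (tensorOp a b) = ρ a • b := by
  let form (x : HilbertTensor H K →L[ℂ] HilbertTensor H K) : K →L⋆[ℂ] K →L[ℂ] ℂ :=
    LinearMap.mkContinuous₂ (LinearMap.mk₂'ₛₗ (starRingEnd ℂ) (RingHom.id ℂ)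
      (fun y y' => ρ (compress x y y'))
      (fun y z y' => by simp [compress, tmulRight_add, ContinuousLinearMap.add_comp])
      (fun c y y' => by
        simp [compress, tmulRight_smul, ContinuousLinearMap.smul_comp, LinearIsometryEquiv.map_smulₛₗ])
      (fun y z y' => by simp [compress, tmulRight_add, ContinuousLinearMap.comp_add])
      (fun c y y' => by simp [compress, tmulRight_smul]))
      (‖ρ‖ * ‖x‖) (fun y y' => by
        refine (ρ.le_opNorm _).trans ?_
        have := mul_le_mul_of_nonneg_left (norm_compress_le x y y') (norm_nonneg ρ)
        calc _ ≤ _ := this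
          _ = _ := by ring)
  have hform (x y y') : form x y y' = ρ (compress x y y') := rfl
  let S (x : HilbertTensor H K →L[ℂ] HilbertTensor H K) : K →L[ℂ] K :=
    ContinuousLinearMap.adjoint (InnerProductSpace.continuousLinearMapOfBilin (form x))
  have hS (x y y') : inner ℂ y (S x y') = ρ (compress x y y') := by
    simp [S, ContinuousLinearMap.adjoint_inner_right, hform]
  refine ⟨LinearMap.mkContinuous
    { toFun := S
      map_add' := fun x x' => ?_
      map_smul' := fun c x => ?_ } ‖ρ‖ (fun x => ?_), fun a b => ?_⟩
  · ext y'
    refine ext_inner_left ℂ fun y => ?_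
    simp [hS, inner_add_right, compress, ContinuousLinearMap.add_comp,
      ContinuousLinearMap.comp_add]
  · ext y'
    refine ext_inner_left ℂ fun y => ?_
    simp [hS, inner_smul_right, compress, ContinuousLinearMap.smul_comp]
  · change ‖S x‖ ≤ _
    refine ContinuousLinearMap.opNorm_le_bound _ (by positivity) fun y' => ?_
    have h1 : ‖S x y'‖ * ‖S x y'‖ ≤ (‖ρ‖ * ‖x‖ * ‖y'‖) * ‖S x y'‖ := by
      have h2 : ‖(inner ℂ (S x y') (S x y') : ℂ)‖ = ‖S x y'‖ * ‖S x y'‖ := by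
        rw [inner_self_eq_norm_sq_to_K]
        simp [pow_two]
      rw [← h2, hS]
      refine (ρ.le_opNorm _).trans ?_
      refine (mul_le_mul_of_nonneg_left (norm_compress_le x _ y') (norm_nonneg ρ)).trans ?_
      exact le_of_eq (by ring)
    by_cases h0 : ‖S x y'‖ = 0
    · rw [h0]
      positivity
    · exact le_of_mul_le_mul_right h1 (lt_of_le_of_ne (norm_nonneg _) (Ne.symm h0))
  · change S (tensorOp a b) = _
    ext y'
    refine ext_inner_left ℂ fun y => ?_
    simp [hS, compress_tensorOp, inner_smul_right, mul_comm]

/-- For bounded functionals `ρ` on `A` and `φ` on `B` there is exactly one bounded functional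
`ρ ⊗ φ` on the spatial tensor product with `(ρ ⊗ φ)(a ⊗ b) = ρ(a) φ(b)`. -/
theorem existsUnique_tensorFunctional (ρ : StrongDual ℂ A) (φ : StrongDual ℂ B) :
    ∃! Θ : StrongDual ℂ (spatialTensor A B), ∀ a b, Θ (elemTensor a b) = ρ a * φ b := by
  obtain ⟨ρ', hρ', -⟩ := exists_extension_norm_eq (𝕜 := ℂ) (Subalgebra.toSubmodule A.toSubalgebra) ρ
  obtain ⟨φ', hφ', -⟩ := exists_extension_norm_eq (𝕜 := ℂ) (Subalgebra.toSubmodule B.toSubalgebra) φ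
  obtain ⟨R, hR⟩ := exists_slice (K := K) ρ'
  refine ⟨(φ' ∘L R) ∘L (Subalgebra.toSubmodule (spatialTensor A B).toSubalgebra).subtypeL, ?_, ?_⟩
  · intro a b
    change φ' (R (tensorOp _ _)) = _
    rw [hR, map_smul, smul_eq_mul]
    congr 1
    · exact hρ' a
    · exact hφ' b
  · intro Θ hΘ
    obtain ⟨Θ', hΘ', -⟩ := exists_extension_norm_eq (𝕜 := ℂ)
      (Subalgebra.toSubmodule (spatialTensor A B).toSubalgebra) Θ
    have hc : Set.EqOn Θ' (φ' ∘L R)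
        (spatialTensor A B : Set (HilbertTensor H K →L[ℂ] HilbertTensor H K)) := by
      rw [spatialTensor_eq_closure]
      refine Set.EqOn.closure ?_ Θ'.continuous (φ' ∘L R).continuous
      refine LinearMap.eqOn_span (f := Θ'.toLinearMap) (g := (φ' ∘L R).toLinearMap) ?_
      rintro _ ⟨a, ha, b, hb, rfl⟩
      change Θ' (tensorOp a b) = φ' (R (tensorOp a b))
      rw [hR, map_smul, smul_eq_mul]
      have h1 := hΘ' (elemTensor ⟨a, ha⟩ ⟨b, hb⟩)
      have h2 := hΘ ⟨a, ha⟩ ⟨b, hb⟩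
      rw [← hρ' ⟨a, ha⟩, ← hφ' ⟨b, hb⟩] at h2
      exact h1.trans h2
    ext x
    rw [← hΘ' x]
    exact hc x.2

/-- The functional `ρ ⊗ φ` on the spatial tensor product. -/
def tensorFunctional (ρ : StrongDual ℂ A) (φ : StrongDual ℂ B) :
    StrongDual ℂ (spatialTensor A B) :=
  (existsUnique_tensorFunctional ρ φ).choose

theorem tensorFunctional_apply (ρ : StrongDual ℂ A) (φ : StrongDual ℂ B) (a : A) (b : B) :
    tensorFunctional ρ φ (elemTensor a b) = ρ a * φ b :=
  (existsUnique_tensorFunctional ρ φ).choose_spec.1 a b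


theorem hilbertBasis_ext {ι F : Type*} [NormedAddCommGroup F] [NormedSpace ℂ F]
    (b : HilbertBasis ι ℂ H) {f g : H →L[ℂ] F} (h : ∀ i, f (b i) = g (b i)) : f = g := by
  refine ContinuousLinearMap.ext_on (s := Set.range b) ?_ ?_
  · have := b.dense_span
    rwa [Submodule.dense_iff_topologicalClosure_eq_top]
  · rintro _ ⟨i, rfl⟩
    exact h i

/-- The Hilbert basis of a Hilbert space tensor product given by two Hilbert bases. -/
theorem exists_tensorBasis {ι κ σ : Type*} (b : HilbertBasis ι ℂ H) (c : HilbertBasis κ ℂ K)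
    (e : σ ≃ ι × κ) :
    ∃ d : HilbertBasis σ ℂ (HilbertTensor H K), ∀ s, d s = tmul (b (e s).1) (c (e s).2) := by
  have ho : Orthonormal ℂ fun s => tmul (b (e s).1) (c (e s).2) := by
    have := (b.orthonormal.tmul c.orthonormal).comp e e.injective
    exact this.comp_linearIsometry embed
  have hd : (Submodule.span ℂ (Set.range fun s => tmul (b (e s).1) (c (e s).2)))ᗮ = ⊥ := by
    rw [Submodule.eq_bot_iff]
    intro z hz
    have h0 : ∀ i j, inner ℂ z (tmul (b i) (c j)) = 0 := fun i j => by
      have hm : tmul (b i) (c j) ∈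
          Submodule.span ℂ (Set.range fun s => tmul (b (e s).1) (c (e s).2)) :=
        Submodule.subset_span ⟨e.symm (i, j), by simp⟩
      exact Submodule.inner_left_of_mem_orthogonal hm hz
    have h1 : ∀ j x, inner ℂ z (tmul x (c j)) = 0 := fun j x => by
      have : (innerSL ℂ z) ∘L (tmulRight (c j)) = 0 :=
        hilbertBasis_ext b fun i => h0 i j
      exact DFunLike.congr_fun this x
    have h2 : ∀ x y, inner ℂ z (tmul x y) = 0 := fun x y => by
      let f : K →L[ℂ] HilbertTensor H K := embed.toContinuousLinearMap ∘L TensorProduct.mkL ℂ H K x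
      have : (innerSL ℂ z) ∘L f = 0 := hilbertBasis_ext c fun j => h1 j x
      exact DFunLike.congr_fun this y
    have h3 : innerSL ℂ z = 0 := op_ext fun x y => h2 x y
    exact inner_self_eq_zero.1 (DFunLike.congr_fun h3 z)
  exact ⟨HilbertBasis.mkOfOrthogonalEqBot ho hd, fun s => by
    rw [HilbertBasis.coe_mkOfOrthogonalEqBot]⟩

/-- The amplification `a ↦ a ⊗ 1`. -/
def amplify (K : Type*) [NormedAddCommGroup K] [InnerProductSpace ℂ K] [CompleteSpace K] :
    (H →L[ℂ] H) →⋆ₐ[ℂ] (HilbertTensor H K →L[ℂ] HilbertTensor H K) where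
  toFun a := tensorOp a 1
  map_one' := tensorOp_one
  map_mul' a a' := by rw [← tensorOp_mul, one_mul]
  map_zero' := op_ext fun x y => by
    rw [tensorOp_tmul]
    simpa using tmul_smul_left (0 : ℂ) (0 : H) y
  map_add' a a' := op_ext fun x y => by simp [tensorOp_tmul, tmul_add_left]
  commutes' r := op_ext fun x y => by
    simp [tensorOp_tmul, Algebra.algebraMap_eq_smul_one, tmul_smul_left]
  map_star' a := by rw [tensorOp_star, star_one]

end Tensor

/-! ### The comultiplication and the product of the dual space -/

/-- The index bijection `(n, d) ↦ (n + d⁺, n + d⁻)`. -/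
def indexEquiv : ℕ × ℤ ≃ ℕ × ℕ where
  toFun p := (p.1 + p.2.toNat, p.1 + (-p.2).toNat)
  invFun q := (min q.1 q.2, (q.1 : ℤ) - q.2)
  left_inv p := by ext <;> simp; omega
  right_inv q := by ext <;> simp <;> omega

/-- The standard basis vectors of `ℓ²`, as a Hilbert basis. -/
def stdBasis (ι : Type*) : HilbertBasis ι ℂ (lp (fun _ : ι => ℂ) 2) :=
  ⟨LinearIsometryEquiv.refl ℂ _⟩

theorem shift_stdBasis (n : ℕ) : shift (stdBasis ℕ n) = stdBasis ℕ (n + 1) := by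
  classical
  ext k
  rw [← HilbertBasis.repr_symm_single, ← HilbertBasis.repr_symm_single]
  change (Nat.casesOn k 0 (fun k => (lp.single 2 n (1 : ℂ) : Ell2) k) : ℂ) =
    (lp.single 2 (n + 1) (1 : ℂ) : Ell2) k
  cases k with
  | zero => simp [lp.single_apply]
  | succ k => simp [lp.single_apply, Pi.single_apply]

/-- The C*-algebra `𝒯 ⊗ 𝒯`. -/
abbrev toeplitz₂ : StarSubalgebra ℂ (HilbertTensor Ell2 Ell2 →L[ℂ] HilbertTensor Ell2 Ell2) :=
  spatialTensor toeplitz toeplitz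

/-- The shift as an element of the Toeplitz algebra. -/
def T : toeplitz := ⟨shift, shift_mem⟩

/-- The operator `T_{n,m}` as an element of the Toeplitz algebra. -/
def Tmon (n m : ℕ) : toeplitz := ⟨monomial n m, monomial_mem n m⟩

/-- There is exactly one unital *-homomorphism `Δ : 𝒯 → 𝒯 ⊗ 𝒯` with `Δ(T) = T ⊗ T`. -/
theorem existsUnique_comul :
    ∃! Δ : toeplitz →⋆ₐ[ℂ] toeplitz₂, Δ T = elemTensor T T := by
  obtain ⟨b₁, hb₁⟩ := exists_tensorBasis (stdBasis ℕ) (stdBasis ℤ) (Equiv.refl _)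
  obtain ⟨b₂, hb₂⟩ := exists_tensorBasis (stdBasis ℕ) (stdBasis ℕ) indexEquiv
  let U := b₁.repr.trans b₂.repr.symm
  have hU (i) : U (b₁ i) = b₂ i := by
    classical
    simp [U, HilbertBasis.repr_self]
  have hU' (i) : U.symm (b₂ i) = b₁ i := by rw [← hU, LinearIsometryEquiv.symm_apply_apply]
  let Ψ : (Ell2 →L[ℂ] Ell2) →⋆ₐ[ℂ] (HilbertTensor Ell2 Ell2 →L[ℂ] HilbertTensor Ell2 Ell2) :=
    (U.conjStarAlgEquiv.toStarAlgHom).comp (amplify (lp (fun _ : ℤ => ℂ) 2))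
  have hΨc : Continuous Ψ := map_continuous Ψ
  have hΨ : Ψ shift = tensorOp shift shift := by
    refine hilbertBasis_ext b₂ fun i => ?_
    change U (tensorOp shift 1 (U.symm (b₂ i))) = _
    obtain ⟨n, d⟩ := i
    have h1 : b₁ (n + 1, d) = tensorOp shift 1 (b₁ (n, d)) := by
      simp [hb₁, tensorOp_tmul, shift_stdBasis]
    rw [hU', ← h1, hU, hb₂, hb₂, tensorOp_tmul, shift_stdBasis, shift_stdBasis]
    simp only [indexEquiv, Equiv.coe_fn_mk]
    congr 2 <;> omega
  have hmem : toeplitz ≤ toeplitz₂.comap Ψ := by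
    refine (StarAlgebra.elemental.le_iff_mem ?_).2 ?_
    · exact (StarSubalgebra.isClosed_topologicalClosure _).preimage hΨc
    · change Ψ shift ∈ toeplitz₂
      rw [hΨ]
      exact tensorOp_mem shift_mem shift_mem
  have hcont (Δ : toeplitz →⋆ₐ[ℂ] toeplitz₂) : Continuous Δ := by
    have : IsClosed (toeplitz : Set (Ell2 →L[ℂ] Ell2)) := isClosed_toeplitz
    have : IsClosed (toeplitz₂ : Set (HilbertTensor Ell2 Ell2 →L[ℂ] HilbertTensor Ell2 Ell2)) :=
      StarSubalgebra.isClosed_topologicalClosure _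
    exact AddMonoidHomClass.continuous_of_bound Δ 1 fun x => by
      simpa using NonUnitalStarAlgHom.norm_apply_le Δ x
  have h₀ : (Ψ.comp toeplitz.subtype).codRestrict toeplitz₂ (fun x => hmem x.2) T =
      elemTensor T T := Subtype.ext hΨ
  exact ⟨_, h₀, fun Δ hΔ => StarAlgebra.elemental.starAlgHomClass_ext ℂ (hcont Δ) (hcont _)
    (hΔ.trans h₀.symm)⟩

/-- The comultiplication of the Toeplitz algebra. -/
def comul : toeplitz →⋆ₐ[ℂ] toeplitz₂ := existsUnique_comul.choose

theorem comul_T : comul T = elemTensor T T := existsUnique_comul.choose_spec.1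

/-- The product `ρ ∗ φ = (ρ ⊗ φ) ∘ Δ` of the dual space `𝒯*`. -/
def dualMul (ρ φ : StrongDual ℂ toeplitz) : StrongDual ℂ toeplitz :=
  LinearMap.mkContinuousOfExistsBound
    ((tensorFunctional ρ φ).toLinearMap ∘ₗ comul.toAlgHom.toLinearMap) <| by
      have : IsClosed (toeplitz : Set (Ell2 →L[ℂ] Ell2)) := isClosed_toeplitz
      have : IsClosed (toeplitz₂ : Set (HilbertTensor Ell2 Ell2 →L[ℂ] HilbertTensor Ell2 Ell2)) :=
        StarSubalgebra.isClosed_topologicalClosure _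
      refine ⟨‖tensorFunctional ρ φ‖, fun A => ((tensorFunctional ρ φ).le_opNorm _).trans ?_⟩
      exact mul_le_mul_of_nonneg_left (NonUnitalStarAlgHom.norm_apply_le comul A) (norm_nonneg _)

theorem dualMul_apply (ρ φ : StrongDual ℂ toeplitz) (A : toeplitz) :
    dualMul ρ φ A = tensorFunctional ρ φ (comul A) := rfl

/-- The compact operators in the Toeplitz algebra (which contains all compact operators), as a
subspace of `𝒯`. -/
def compacts : Submodule ℂ toeplitz where
  carrier := {A | IsCompactOperator (A : Ell2 →L[ℂ] Ell2)}
  add_mem' hA hB := hA.add hB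
  zero_mem' := isCompactOperator_zero
  smul_mem' c _ hA := hA.smul c

/-- The annihilator `𝒦^⊥` of the compact operators in `𝒯*`. -/
def annihilator : Submodule ℂ (StrongDual ℂ toeplitz) where
  carrier := {ρ | ∀ A ∈ compacts, ρ A = 0}
  add_mem' hρ hφ A hA := by simp [hρ A hA, hφ A hA]
  zero_mem' _ _ := rfl
  smul_mem' c _ hρ A hA := by simp [hρ A hA]

/-! ### Complex Borel measures on the circle -/

instance : MeasurableSpace Circle := borel Circle

instance : BorelSpace Circle := ⟨rfl⟩

/-- A complex measure has finite total variation. -/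
instance {X : Type*} [MeasurableSpace X] (μ : ComplexMeasure X) : IsFiniteMeasure μ.variation := by
  refine isFiniteMeasure_of_le
    ((ComplexMeasure.re μ).totalVariation + (ComplexMeasure.im μ).totalVariation) ?_
  refine VectorMeasure.variation_le_of_forall_enorm_le fun s hs => ?_
  have h1 := SignedMeasure.enorm_le_totalVariation (ComplexMeasure.re μ) s
  have h2 := SignedMeasure.enorm_le_totalVariation (ComplexMeasure.im μ) s
  have h3 : ‖μ s‖ₑ ≤ ‖(μ s).re‖ₑ + ‖(μ s).im‖ₑ := by
    have h := Complex.norm_le_abs_re_add_abs_im (μ s)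
    rw [← Real.norm_eq_abs, ← Real.norm_eq_abs] at h
    simpa [← ofReal_norm, ENNReal.ofReal_add] using ENNReal.ofReal_le_ofReal h
  exact h3.trans (add_le_add h1 h2)

/-- Every complex Borel measure on the circle is regular, so that `M(S¹)` is
`ComplexMeasure Circle`. -/
theorem regular_variation (μ : ComplexMeasure Circle) : μ.variation.Regular := inferInstance

/-- The norm of `M(S¹)`: the total variation. -/
def totalVariationNorm (μ : ComplexMeasure Circle) : ℝ := (μ.variation Set.univ).toReal

/-- The integral of a complex function against a complex measure on the circle. -/
def cintegral (μ : ComplexMeasure Circle) (f : Circle → ℂ) : ℂ :=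
  μ.integral f (ContinuousLinearMap.mul ℝ ℂ)

/-- The convolution of two complex measures on the circle: the image of the product measure under
the multiplication of the circle. -/
def mconv (μ ν : ComplexMeasure Circle) : ComplexMeasure Circle :=
  (μ.prod ν (ContinuousLinearMap.mul ℝ ℂ)).map fun p => p.1 * p.2

end ToeplitzQuantumSemigroup

end

open MeasureTheory ToeplitzQuantumSemigroup

noncomputable section

open MeasureTheory Topology Filter
open scoped ENNReal NNReal CompactlySupported InnerProductSpace

namespace ToeplitzQuantumSemigroup

/-! ### The Riesz representation theorem for complex measures -/

section Riesz

/-! Everything is tested on the operators $T_{n,m}$. Since $T^*T=1$, they span a dense subspace of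
$\mathcal T$ (`toeplitz_ext`). They are group-like, $\Delta(T_{n,m})=T_{n,m}\otimes T_{n,m}$, so
$(\rho\ast\varphi)(T_{n,m})=\rho(T_{n,m})\varphi(T_{n,m})$ (`dualMul_Tmon`). On the other side,
$\int z^k\,d(\mu\ast\nu)=\int z^k\,d\mu\int z^k\,d\nu$ (`cintegral_mconv_circlePow`). Hence
$\Phi(\mu\ast\nu)$ and $\Phi(\mu)\ast\Phi(\nu)$ agree on a dense subspace. As $\Phi$ is onto
$\mathcal K^\perp$, this identity also shows that $\mathcal K^\perp$ is closed under $\ast$.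

The isometry $\mathcal T/\mathcal K\cong C(S^1)$ rests on `norm_mk_combTmon`, a norm equality for a
combination $x$ of the $T_{n,m}$ with symbol $f=\sum c_{n,m}z^{m-n}$. For $\|f\|\le\|x+K\|$ with $K$
compact, weakly null approximate eigenvectors of the shift recover $f(z)$ as a limit of $\langle
v_N,(x+K)v_N\rangle$. For the converse, the compression to $\ell^2(\mathbb Z_+)$ of $f(U^*)$, with
$U$ the bilateral shift, has norm at most $\|f\|$ and differs from $x$ by a compact operator. The
algebraic properties are then checked on the $T_{n,m}$.

The identification of $M(S^1)$ with $C(S^1)^*$ is the Riesz theorem for complex measures. The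
variation of a functional $F$ is additive on nonnegative functions, hence is given by a positive
measure $\lambda$. Then $F$ extends to a contraction on $L^1(\lambda)$, whose values on indicators
form a complex measure dominated by $\lambda$. -/

theorem integral_indicator_const {X : Type*} [MeasurableSpace X] (μ : ComplexMeasure X) {s : Set X}
    (hs : MeasurableSet s) (c : ℂ) :
    μ.integral (s.indicator fun _ => c) (ContinuousLinearMap.mul ℝ ℂ) = c * μ s := by
  have : IsFiniteMeasure (μ.restrict s).variation := by
    rw [VectorMeasure.variation_restrict hs]; infer_instance
  rw [VectorMeasure.integral_indicator hs, VectorMeasure.integral_const]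
  simp [VectorMeasure.restrict_apply, hs]

variable {X : Type*} [MetricSpace X] [CompactSpace X]

/-- Continuous functions are dense in $L^1(|\mu|)$ and the integral is continuous there, so it also
vanishes on indicators. -/
theorem complexMeasure_eq_zero_of_integral [MeasurableSpace X] [BorelSpace X] (μ : ComplexMeasure X)
    (h : ∀ f : C(X, ℂ), μ.integral f (ContinuousLinearMap.mul ℝ ℂ) = 0) : μ = 0 := by
  have key : ∀ f : X →₁[μ.variation] ℂ, μ.integral f (ContinuousLinearMap.mul ℝ ℂ) = 0 := by
    intro f
    refine (ContinuousMap.toLp_denseRange ℂ μ.variation ℂ (p := 1) (by simp)).induction_on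
      (p := fun f : X →₁[μ.variation] ℂ => μ.integral f (ContinuousLinearMap.mul ℝ ℂ) = 0) f ?_ ?_
    · exact isClosed_eq VectorMeasure.continuous_integral continuous_const
    · intro f
      rw [← h f]
      exact VectorMeasure.integral_congr_ae (ContinuousMap.coeFn_toLp μ.variation f)
  ext s hs
  rw [← one_mul (μ s), ← integral_indicator_const μ hs]
  have := key (indicatorConstLp 1 hs (measure_ne_top μ.variation s) 1)
  rw [VectorMeasure.integral_congr_ae indicatorConstLp_coeFn] at this
  simpa using this

/-- The value of the variation `|F|` of a bounded functional `F` on a nonnegative function `f`. -/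
def dualVariation (F : StrongDual ℂ C(X, ℂ)) (f : X → ℝ≥0) : ℝ≥0 :=
  ⨆ g : {g : C(X, ℂ) // ∀ x, ‖g x‖₊ ≤ f x}, ‖F g‖₊

theorem nnnorm_apply_le_of_le (F : StrongDual ℂ C(X, ℂ)) {f : X → ℝ≥0} {C : ℝ≥0}
    (hC : ∀ x, f x ≤ C) (g : {g : C(X, ℂ) // ∀ x, ‖g x‖₊ ≤ f x}) : ‖F g‖₊ ≤ ‖F‖₊ * C := by
  refine (F.le_opNNNorm _).trans ?_
  gcongr
  exact (ContinuousMap.norm_le _ C.2).2 fun x => (g.2 x).trans (hC x)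

theorem bddAbove_dualVariation (F : StrongDual ℂ C(X, ℂ)) {f : X → ℝ≥0} (hf : Continuous f) :
    BddAbove (Set.range fun g : {g : C(X, ℂ) // ∀ x, ‖g x‖₊ ≤ f x} => ‖F g‖₊) := by
  obtain ⟨C, hC⟩ := (isCompact_range hf).bddAbove
  refine ⟨‖F‖₊ * C, ?_⟩
  rintro _ ⟨g, rfl⟩
  exact nnnorm_apply_le_of_le F (fun x => hC ⟨x, rfl⟩) g

theorem le_dualVariation (F : StrongDual ℂ C(X, ℂ)) {f : X → ℝ≥0} (hf : Continuous f)
    {g : C(X, ℂ)} (hg : ∀ x, ‖g x‖₊ ≤ f x) : ‖F g‖₊ ≤ dualVariation F f :=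
  le_ciSup (bddAbove_dualVariation F hf) (⟨g, hg⟩ : {g : C(X, ℂ) // ∀ x, ‖g x‖₊ ≤ f x})

instance (f : X → ℝ≥0) : Nonempty {g : C(X, ℂ) // ∀ x, ‖g x‖₊ ≤ f x} :=
  ⟨⟨0, fun x => by simp⟩⟩

theorem dualVariation_le_of_le (F : StrongDual ℂ C(X, ℂ)) {f : X → ℝ≥0} {C : ℝ≥0}
    (hC : ∀ x, f x ≤ C) : dualVariation F f ≤ ‖F‖₊ * C :=
  ciSup_le fun g => nnnorm_apply_le_of_le F hC g

theorem exists_norm_one_mul_eq_norm (z : ℂ) : ∃ c : ℂ, ‖c‖ = 1 ∧ c * z = (‖z‖ : ℂ) := by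
  rcases eq_or_ne z 0 with rfl | hz
  · exact ⟨1, by simp⟩
  · have hz' : (‖z‖ : ℂ) ≠ 0 := by simpa using hz
    refine ⟨(‖z‖ : ℂ) / z, by simp [hz], by field_simp⟩

/-- For $\le$, a competitor $g$ for $f_1+f_2$ is split in the proportion $f_1:f_2$. For $\ge$,
competitors $g_1,g_2$ are multiplied by unimodular constants that make $F(g_1)$ and $F(g_2)$
nonnegative; then their sum is a competitor. -/
theorem dualVariation_add (F : StrongDual ℂ C(X, ℂ)) {f₁ f₂ : X → ℝ≥0} (h₁ : Continuous f₁)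
    (h₂ : Continuous f₂) : dualVariation F (f₁ + f₂) = dualVariation F f₁ + dualVariation F f₂ := by
  apply le_antisymm
  · refine ciSup_le fun ⟨g, hg⟩ => ?_
    change ‖F g‖₊ ≤ _
    refine le_of_forall_pos_le_add fun ε hε => ?_
    obtain ⟨δ, hδ, hδε⟩ : ∃ δ : ℝ≥0, 0 < δ ∧ ‖F‖₊ * δ ≤ ε := by
      refine ⟨ε / (‖F‖₊ + 1), by positivity, ?_⟩
      rw [← mul_div_assoc]
      exact div_le_of_le_mul₀ (by positivity) (by positivity)
        (by rw [mul_comm]; gcongr; exact le_self_add)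
    -- The extra $\delta$ keeps the denominator positive, hence the pieces continuous, where
    -- $f_1+f_2$ vanishes. The price is a third piece bounded by $\delta$, on which $F$ is at most
    -- `ε`.
    let q (f : X → ℝ≥0) (x : X) : ℝ≥0 := f x / (f₁ x + f₂ x + δ)
    have hpos (x : X) : f₁ x + f₂ x + δ ≠ 0 := (by positivity : 0 < f₁ x + f₂ x + δ).ne'
    have hq {f : X → ℝ≥0} (hf : Continuous f) : Continuous (q f) :=
      hf.div (by fun_prop) hpos
    let G {f : X → ℝ≥0} (hf : Continuous f) : C(X, ℂ) :=
      ⟨fun x => ((q f x : ℝ) : ℂ) * g x, by have := hq hf; fun_prop⟩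
    have hG {f : X → ℝ≥0} (hf : Continuous f) (x : X) : ‖G hf x‖₊ ≤ f x := by
      have h1 : ‖G hf x‖₊ = q f x * ‖g x‖₊ := by simp [G]
      rw [h1, div_mul_eq_mul_div]
      refine div_le_of_le_mul₀ (by positivity) (by positivity) ?_
      gcongr
      exact (hg x).trans le_self_add
    have hsum : g = G h₁ + G h₂ + G (f := fun _ => δ) continuous_const := by
      ext x
      have : q f₁ x + q f₂ x + q (fun _ => δ) x = 1 := by
        simp only [q, ← add_div]
        exact div_self (hpos x)
      have h' : ((q f₁ x : ℝ) : ℂ) + ((q f₂ x : ℝ) : ℂ) + ((q (fun _ => δ) x : ℝ) : ℂ) = 1 := by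
        exact_mod_cast this
      change g x = _ * g x + _ * g x + _ * g x
      rw [← add_mul, ← add_mul, h', one_mul]
    rw [hsum, map_add, map_add]
    refine (nnnorm_add_le _ _).trans (add_le_add ((nnnorm_add_le _ _).trans (add_le_add ?_ ?_)) ?_)
    · exact le_dualVariation F h₁ (hG h₁)
    · exact le_dualVariation F h₂ (hG h₂)
    · exact (nnnorm_apply_le_of_le F (f := fun _ => δ) (fun _ => le_rfl)
        ⟨_, hG (f := fun _ => δ) continuous_const⟩).trans hδε
  · suffices key : ∀ (g₁ : {g : C(X, ℂ) // ∀ x, ‖g x‖₊ ≤ f₁ x})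
        (g₂ : {g : C(X, ℂ) // ∀ x, ‖g x‖₊ ≤ f₂ x}),
        ‖F g₁‖₊ + ‖F g₂‖₊ ≤ dualVariation F (f₁ + f₂) by
      -- The suprema over $g_2$ and $g_1$ are taken one at a time by moving the other term across
      -- with truncated subtraction. Taking the zero function as competitor shows that nothing is
      -- truncated.
      have h : ∀ g₁ : {g : C(X, ℂ) // ∀ x, ‖g x‖₊ ≤ f₁ x},
          ‖F g₁‖₊ + dualVariation F f₂ ≤ dualVariation F (f₁ + f₂) := fun g₁ =>
        add_le_of_le_tsub_left_of_le (le_self_add.trans (key g₁ ⟨0, fun x => by simp⟩))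
          (ciSup_le fun g₂ => le_tsub_of_add_le_left (key g₁ g₂))
      exact add_le_of_le_tsub_right_of_le (le_add_self.trans (h ⟨0, fun x => by simp⟩))
        (ciSup_le fun g₁ => le_tsub_of_add_le_right (h g₁))
    rintro ⟨g₁, hg₁⟩ ⟨g₂, hg₂⟩
    change ‖F g₁‖₊ + ‖F g₂‖₊ ≤ _
    obtain ⟨c₁, hc₁, h1⟩ := exists_norm_one_mul_eq_norm (F g₁)
    obtain ⟨c₂, hc₂, h2⟩ := exists_norm_one_mul_eq_norm (F g₂)
    have hle := le_dualVariation F (h₁.add h₂) (g := c₁ • g₁ + c₂ • g₂) fun x => by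
      refine (nnnorm_add_le _ _).trans (add_le_add ?_ ?_)
      · simpa [← NNReal.coe_le_coe, hc₁] using hg₁ x
      · simpa [← NNReal.coe_le_coe, hc₂] using hg₂ x
    refine le_trans (le_of_eq ?_) hle
    rw [map_add, map_smul, map_smul, smul_eq_mul, smul_eq_mul, h1, h2, ← NNReal.coe_inj]
    push_cast
    rw [← Complex.ofReal_add, Complex.norm_real, Real.norm_of_nonneg (by positivity)]

/-- Scaling competitors gives one inequality for every $c$; applied to $c^{-1}$ it gives the other.
-/
theorem dualVariation_smul (F : StrongDual ℂ C(X, ℂ)) (c : ℝ≥0) {f : X → ℝ≥0} (hf : Continuous f) :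
    dualVariation F (c • f) = c * dualVariation F f := by
  have key (c : ℝ≥0) {f : X → ℝ≥0} (hf : Continuous f) :
      c * dualVariation F f ≤ dualVariation F (c • f) := by
    rw [dualVariation, NNReal.mul_iSup]
    refine ciSup_le fun ⟨g, hg⟩ => ?_
    have := le_dualVariation F (hf.const_smul c) (g := ((c : ℝ) : ℂ) • g) fun x => by
      simpa [nnnorm_smul] using mul_le_mul_right (hg x) c
    simpa [nnnorm_smul] using this
  refine le_antisymm ?_ (key c hf)
  rcases eq_or_ne c 0 with rfl | hc
  · refine (dualVariation_le_of_le F (C := 0) fun x => by simp).trans (by simp)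
  · have := key c⁻¹ (hf.const_smul c)
    rw [smul_smul, inv_mul_cancel₀ hc, one_smul] at this
    calc _ = c * (c⁻¹ * dualVariation F (c • f)) := by rw [← mul_assoc, mul_inv_cancel₀ hc, one_mul]
      _ ≤ _ := by gcongr

/-- Every bounded functional on `C(X)` is dominated by a positive measure of total mass at most
its norm. -/
theorem exists_measure_dominating [MeasurableSpace X] [BorelSpace X] (F : StrongDual ℂ C(X, ℂ)) :
    ∃ lam : Measure X, lam Set.univ ≤ ‖F‖ₑ ∧ ∀ g : C(X, ℂ), ‖F g‖ₑ ≤ ∫⁻ x, ‖g x‖ₑ ∂lam := by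
  let L : C_c(X, ℝ≥0) →ₗ[ℝ≥0] ℝ≥0 :=
    { toFun := fun f => dualVariation F f
      map_add' := fun f g => dualVariation_add F f.continuous g.continuous
      map_smul' := fun c f => dualVariation_smul F c f.continuous }
  refine ⟨NNRealRMK.rieszMeasure L, ?_, fun g => ?_⟩
  -- Testing against the constant function 1 computes the total mass.
  · have h := NNRealRMK.lintegral_rieszMeasure L
      (CompactlySupportedContinuousMap.continuousMapEquiv (1 : C(X, ℝ≥0)))
    have h1 : ∫⁻ x, ((CompactlySupportedContinuousMap.continuousMapEquiv (1 : C(X, ℝ≥0)) x : ℝ≥0) :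
        ℝ≥0∞) ∂(NNRealRMK.rieszMeasure L) = NNRealRMK.rieszMeasure L Set.univ := by
      rw [← lintegral_one]; rfl
    rw [← h1, h, enorm_eq_nnnorm, ENNReal.coe_le_coe]
    exact (dualVariation_le_of_le F (C := 1) fun x => le_rfl).trans (by simp)
  · let f : C(X, ℝ≥0) := ⟨fun x => ‖g x‖₊, by fun_prop⟩
    have h := NNRealRMK.lintegral_rieszMeasure L
      (CompactlySupportedContinuousMap.continuousMapEquiv f)
    calc ‖F g‖ₑ ≤ (L (CompactlySupportedContinuousMap.continuousMapEquiv f) : ℝ≥0∞) := by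
          rw [enorm_eq_nnnorm, ENNReal.coe_le_coe]
          exact le_dualVariation F f.continuous fun x => le_rfl
      _ = _ := by rw [← h]; rfl

/-- A set function dominated by a finite measure which comes from a bounded functional on `L¹`. -/
theorem exists_complexMeasure_of_L1 {X : Type*} [MeasurableSpace X] {lam : Measure X}
    [IsFiniteMeasure lam] (G : StrongDual ℂ (X →₁[lam] ℂ)) (hG : ‖G‖ ≤ 1) :
    ∃ μ : ComplexMeasure X, μ.variation ≤ lam ∧
      ∀ f : X →₁[lam] ℂ, μ.integral f (ContinuousLinearMap.mul ℝ ℂ) = G f := by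
  classical
  -- The value 0 on non-measurable sets is the convention for vector measures.
  let m (s : Set X) : ℂ := if hs : MeasurableSet s then
    G (indicatorConstLp 1 hs (measure_ne_top lam s) 1) else 0
  have hm_of {s : Set X} (hs : MeasurableSet s) :
      m s = G (indicatorConstLp 1 hs (measure_ne_top lam s) 1) := dif_pos hs
  have hm (s : Set X) : ‖m s‖ₑ ≤ lam s := by
    by_cases hs : MeasurableSet s
    · rw [hm_of hs]
      have h1 : ‖G (indicatorConstLp 1 hs (measure_ne_top lam s) 1)‖ ≤ lam.real s := by
        refine (G.le_of_opNorm_le hG _).trans ?_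
        rw [norm_indicatorConstLp (by simp) (by simp)]
        simp
      rw [← ofReal_norm]
      exact (ENNReal.ofReal_le_ofReal h1).trans (by simp)
    · simp [m, hs]
  -- Linearity of $G$ gives only finite additivity; the bound by the finite measure `lam` makes it
  -- countable.
  let μ : ComplexMeasure X := VectorMeasure.of_additive_of_le_measure (μ := lam) m hm
    (fun s t hs ht hst => by
      rw [hm_of hs, hm_of ht, hm_of (hs.union ht), ← map_add]
      congr 1
      exact indicatorConstLp_disjoint_union hs ht (measure_ne_top lam s) (measure_ne_top lam t)
        hst 1)
    (fun s hs => dif_neg hs)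
  have hle : μ.variation ≤ lam := VectorMeasure.variation_le_of_forall_enorm_le fun s _ => hm s
  refine ⟨μ, hle, ?_⟩
  have hT := (dominatedFinMeasAdditive_cbmApplyMeasure μ
    (ContinuousLinearMap.mul ℝ ℂ)).of_measure_le hle
    (ContinuousLinearMap.opNorm_nonneg _)
  -- The integral against $\mu$ lives on $L^1(|\mu|)$. Since $|\mu|\le\lambda$, it can be computed
  -- on $L^1(\lambda)$, where it is continuous and comparable with $G$ on indicators.
  have hint (f : X →₁[lam] ℂ) : μ.integral f (ContinuousLinearMap.mul ℝ ℂ) =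
      L1.setToL1 hT f := by
    rw [← L1.setToFun_eq_setToL1, VectorMeasure.integral_eq_setToFun]
    exact (setToFun_congr_measure_of_integrable 1 (by simp) (by simpa using hle) _ _ f
      (L1.integrable_coeFn f)).symm
  intro f
  rw [hint]
  refine Lp.induction (by simp : (1 : ℝ≥0∞) ≠ ∞) (fun f => L1.setToL1 hT f = G f) ?_ ?_ ?_ f
  · intro c s hs hμs
    have h1 : indicatorConstLp 1 hs hμs.ne c = c • indicatorConstLp 1 hs hμs.ne (1 : ℂ) := by
      ext1
      filter_upwards [Lp.coeFn_smul c (indicatorConstLp 1 hs hμs.ne (1 : ℂ)),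
        indicatorConstLp_coeFn (p := 1) (hs := hs) (hμs := hμs.ne) (c := c),
        indicatorConstLp_coeFn (p := 1) (hs := hs) (hμs := hμs.ne) (c := (1 : ℂ))] with x h1 h2 h3
      classical
      rw [h1, h2, Pi.smul_apply, h3]
      simp [Set.indicator_apply]
    rw [Lp.simpleFunc.coe_indicatorConst, L1.setToL1_indicatorConstLp, h1, map_smul, ← hm_of hs]
    rfl
  · intro f g hf hg _ h1 h2
    rw [map_add, map_add, h1, h2]
  · exact isClosed_eq (ContinuousLinearMap.continuous _) G.continuous

/-- The existence part of the **Riesz representation theorem** for bounded functionals on `C(X)`. -/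
theorem exists_complexMeasure_of_dual [MeasurableSpace X] [BorelSpace X]
    (F : StrongDual ℂ C(X, ℂ)) : ∃ μ : ComplexMeasure X, μ.variation Set.univ ≤ ‖F‖ₑ ∧
      ∀ f : C(X, ℂ), μ.integral f (ContinuousLinearMap.mul ℝ ℂ) = F f := by
  obtain ⟨lam, huniv, hF⟩ := exists_measure_dominating F
  have : IsFiniteMeasure lam := ⟨huniv.trans_lt enorm_lt_top⟩
  have hd := ContinuousMap.toLp_denseRange ℂ lam ℂ (p := 1) (by simp)
  -- Domination says that $F$ is contractive for the $L^1(\lambda)$ seminorm, so it extends from the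
  -- dense image of $C(X)$, even if $C(X)\to L^1(\lambda)$ is not injective.
  have hb (g : C(X, ℂ)) : ‖F.toLinearMap g‖ ≤
      1 * ‖(ContinuousMap.toLp 1 lam ℂ : C(X, ℂ) →L[ℂ] Lp ℂ 1 lam).toLinearMap g‖ := by
    have h := hF g
    have h2 : ‖(ContinuousMap.toLp 1 lam ℂ : C(X, ℂ) →L[ℂ] Lp ℂ 1 lam) g‖ₑ =
        ∫⁻ x, ‖g x‖ₑ ∂lam := by
      rw [Lp.enorm_def, eLpNorm_congr_ae (ContinuousMap.coeFn_toLp lam g),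
        eLpNorm_one_eq_lintegral_enorm]
    rw [← h2, enorm_le_iff_norm_le] at h
    simpa using h
  have hext := LinearMap.extendOfNorm_eq hd ⟨1, hb⟩
  obtain ⟨μ, hle, hμ⟩ := exists_complexMeasure_of_L1
    (F.toLinearMap.extendOfNorm (ContinuousMap.toLp 1 lam ℂ : C(X, ℂ) →L[ℂ] Lp ℂ 1 lam).toLinearMap)
    (LinearMap.opNorm_extendOfNorm_le hd zero_le_one hb)
  refine ⟨μ, (hle _).trans huniv, fun f => ?_⟩
  have := hext f
  rw [← hμ] at this
  refine Eq.trans ?_ this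
  have hae : ⇑(ContinuousMap.toLp 1 lam ℂ f) =ᵐ[μ.variation] f :=
    (Measure.absolutelyContinuous_of_le hle).ae_le (ContinuousMap.coeFn_toLp lam f)
  exact VectorMeasure.integral_congr_ae hae.symm

end Riesz

/-! ### Linearity of complex integrals and integration of product functions -/

section Fubini

variable {X Y : Type*} [MeasurableSpace X] [MeasurableSpace Y]

theorem coe_piecewise_const_zero {s : Set X} (hs : MeasurableSet s) (c : ℂ) :
    ⇑(SimpleFunc.piecewise s hs (SimpleFunc.const X c) (SimpleFunc.const X 0)) =
      s.indicator fun _ => c := by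
  classical
  ext x
  simp [Set.indicator_apply, Set.piecewise]

theorem integral_piecewise_const_zero (μ : ComplexMeasure X) {s : Set X} (hs : MeasurableSet s)
    (c : ℂ) : μ.integral (SimpleFunc.piecewise s hs (SimpleFunc.const X c) (SimpleFunc.const X 0))
      (ContinuousLinearMap.mul ℝ ℂ) = c * μ s := by
  rw [coe_piecewise_const_zero, integral_indicator_const μ hs]

theorem integral_add_simpleFunc (μ : ComplexMeasure X) (f g : SimpleFunc X ℂ) :
    μ.integral (f + g : SimpleFunc X ℂ) (ContinuousLinearMap.mul ℝ ℂ) =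
      μ.integral f (ContinuousLinearMap.mul ℝ ℂ) + μ.integral g (ContinuousLinearMap.mul ℝ ℂ) :=
  VectorMeasure.integral_add (SimpleFunc.integrable_of_isFiniteMeasure f)
    (SimpleFunc.integrable_of_isFiniteMeasure g)

/-- Reduces identities for bounded functions to simple functions; the constant $c$ dominates because
$|\mu|$ is finite. -/
theorem tendsto_integral_approxBounded (μ : ComplexMeasure X) {f : X → ℂ}
    (hf : StronglyMeasurable f) {c : ℝ} (hc : ∀ x, ‖f x‖ ≤ c) :
    Tendsto (fun n => μ.integral (hf.approxBounded c n) (ContinuousLinearMap.mul ℝ ℂ)) atTop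
      (𝓝 (μ.integral f (ContinuousLinearMap.mul ℝ ℂ))) := by
  -- Nonnegativity of $c$ needs a point, as $X$ may be empty.
  have hc' : ∀ x : X, 0 ≤ c := fun x => (norm_nonneg _).trans (hc x)
  refine VectorMeasure.tendsto_integral_of_dominated_convergence (fun _ => c)
    (fun n => (SimpleFunc.stronglyMeasurable _).aestronglyMeasurable) (integrable_const c)
    (fun n => Eventually.of_forall fun x => hf.norm_approxBounded_le (hc' x) n x)
    (Eventually.of_forall fun x => hf.tendsto_approxBounded_of_norm_le (hc x))

theorem integral_smul_complexMeasure (μ : ComplexMeasure X) (a : ℂ) {f : X → ℂ}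
    (hf : StronglyMeasurable f) {c : ℝ} (hc : ∀ x, ‖f x‖ ≤ c) :
    (a • μ).integral f (ContinuousLinearMap.mul ℝ ℂ) =
      a * μ.integral f (ContinuousLinearMap.mul ℝ ℂ) := by
  refine tendsto_nhds_unique (tendsto_integral_approxBounded (a • μ) hf hc)
    (((tendsto_integral_approxBounded μ hf hc).const_mul a).congr fun n => ?_)
  induction hf.approxBounded c n using SimpleFunc.induction with
  | const b hs =>
    refine (congrArg (a * ·) (integral_piecewise_const_zero μ hs b)).trans
      (Eq.trans ?_ (integral_piecewise_const_zero (a • μ) hs b).symm)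
    simp only [smul_apply, smul_eq_mul]
    ring
  | add _ h1 h2 => rw [integral_add_simpleFunc, integral_add_simpleFunc, mul_add, h1, h2]

/-- The integral is built from an $\mathbb R$-bilinear multiplication, so complex homogeneity is
read off from the set function that defines it. -/
theorem integral_const_mul_complexMeasure (μ : ComplexMeasure X) (a : ℂ) (f : X → ℂ) :
    μ.integral (fun x => a * f x) (ContinuousLinearMap.mul ℝ ℂ) =
      a * μ.integral f (ContinuousLinearMap.mul ℝ ℂ) :=
  setToFun_smul (𝕜 := ℂ) _ (fun c s x => by
    change (c • x) * μ s = c • (x * μ s)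
    simp [mul_assoc]) a f

/-- Additivity in each factor reduces to indicators, where the claim is $(\mu\times\nu)(s\times
t)=\mu(s)\nu(t)$. -/
theorem integral_prod_simpleFunc (μ : ComplexMeasure X) (ν : ComplexMeasure Y) (f : SimpleFunc X ℂ)
    (g : SimpleFunc Y ℂ) :
    (μ.prod ν (ContinuousLinearMap.mul ℝ ℂ)).integral (fun p => f p.1 * g p.2)
      (ContinuousLinearMap.mul ℝ ℂ) =
      μ.integral f (ContinuousLinearMap.mul ℝ ℂ) * ν.integral g (ContinuousLinearMap.mul ℝ ℂ) := by
  have hint (f : SimpleFunc X ℂ) (g : SimpleFunc Y ℂ) :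
      (μ.prod ν (ContinuousLinearMap.mul ℝ ℂ)).Integrable (fun p => f p.1 * g p.2) :=
    SimpleFunc.integrable_of_isFiniteMeasure
      (f.comp Prod.fst measurable_fst * g.comp Prod.snd measurable_snd)
  induction f using SimpleFunc.induction with
  | add _ h1 h2 =>
    rw [integral_add_simpleFunc, add_mul, ← h1, ← h2,
      ← VectorMeasure.integral_fun_add (hint _ _) (hint _ _)]
    simp [add_mul]
  | const a hs =>
    rename_i s
    induction g using SimpleFunc.induction with
    | add _ h1 h2 =>
      rw [integral_add_simpleFunc, mul_add, ← h1, ← h2,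
        ← VectorMeasure.integral_fun_add (hint _ _) (hint _ _)]
      simp [mul_add]
    | const b ht =>
      rename_i t
      refine Eq.trans ?_ (congrArg₂ (· * ·) (integral_piecewise_const_zero μ hs a)
        (integral_piecewise_const_zero ν ht b)).symm
      have : (fun p : X × Y => SimpleFunc.piecewise s hs (SimpleFunc.const X a)
          (SimpleFunc.const X 0) p.1 * SimpleFunc.piecewise t ht (SimpleFunc.const Y b)
          (SimpleFunc.const Y 0) p.2) = (s ×ˢ t).indicator fun _ => a * b := by
        classical
        ext p
        rw [coe_piecewise_const_zero, coe_piecewise_const_zero]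
        by_cases h1 : p.1 ∈ s <;> by_cases h2 : p.2 ∈ t <;> simp [h1, h2]
      refine (congrArg (fun F : X × Y → ℂ => (μ.prod ν (ContinuousLinearMap.mul ℝ ℂ)).integral F
        (ContinuousLinearMap.mul ℝ ℂ)) this).trans ?_
      rw [integral_indicator_const _ (hs.prod ht), VectorMeasure.prod_apply]
      simp only [ContinuousLinearMap.mul_apply']
      ring

/-- This special case of Fubini is enough because characters satisfy $\chi(zw)=\chi(z)\chi(w)$. -/
theorem integral_prod_mul_complexMeasure (μ : ComplexMeasure X) (ν : ComplexMeasure Y) {f : X → ℂ}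
    {g : Y → ℂ} (hf : StronglyMeasurable f) (hg : StronglyMeasurable g) {c d : ℝ}
    (hc : ∀ x, ‖f x‖ ≤ c) (hd : ∀ y, ‖g y‖ ≤ d) :
    (μ.prod ν (ContinuousLinearMap.mul ℝ ℂ)).integral (fun p => f p.1 * g p.2)
      (ContinuousLinearMap.mul ℝ ℂ) =
      μ.integral f (ContinuousLinearMap.mul ℝ ℂ) * ν.integral g (ContinuousLinearMap.mul ℝ ℂ) := by
  refine tendsto_nhds_unique ?_ (((tendsto_integral_approxBounded μ hf hc).mul
    (tendsto_integral_approxBounded ν hg hd)).congr fun n =>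
      (integral_prod_simpleFunc μ ν _ _).symm)
  refine VectorMeasure.tendsto_integral_of_dominated_convergence (fun _ => c * d)
    (fun n => (((SimpleFunc.stronglyMeasurable _).comp_measurable measurable_fst).mul
      ((SimpleFunc.stronglyMeasurable _).comp_measurable measurable_snd)).aestronglyMeasurable)
    (integrable_const (c * d)) (fun n => Eventually.of_forall fun p => ?_)
    (Eventually.of_forall fun p => (hf.tendsto_approxBounded_of_norm_le (hc p.1)).mul
      (hg.tendsto_approxBounded_of_norm_le (hd p.2)))
  have hc0 := (norm_nonneg _).trans (hc p.1)
  have hd0 := (norm_nonneg _).trans (hd p.2)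
  rw [norm_mul]
  exact mul_le_mul (hf.norm_approxBounded_le hc0 n _) (hg.norm_approxBounded_le hd0 n _)
    (norm_nonneg _) hc0

end Fubini

/-! ### Monomials in the shift -/

theorem star_shift_mul_shift : star shift * shift = 1 := by
  rw [ContinuousLinearMap.star_eq_adjoint]
  exact (ContinuousLinearMap.norm_map_iff_adjoint_comp_self shift).1 shiftIsometry.norm_map

theorem shift_mul_monomial (n m : ℕ) : shift * monomial n m = monomial (n + 1) m := by
  rw [monomial, monomial, pow_succ', mul_assoc]

theorem star_shift_mul_monomial_zero (m : ℕ) : star shift * monomial 0 m = monomial 0 (m + 1) := by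
  simp [monomial, pow_succ']

theorem star_shift_mul_monomial_succ (n m : ℕ) :
    star shift * monomial (n + 1) m = monomial n m := by
  rw [← shift_mul_monomial, ← mul_assoc, star_shift_mul_shift, one_mul]

theorem star_monomial (n m : ℕ) : star (monomial n m) = monomial m n := by
  simp [monomial]

theorem monomial_zero_zero : monomial 0 0 = 1 := by simp [monomial]

/-- Left multiplication by $T$ or $T^*$ maps the set of the $T_{n,m}$ to itself, because $T^*T=1$.
So every word in $T,T^*$ is some $T_{n,m}$. -/
theorem toeplitz_subset_closure_span :
    (toeplitz : Set (Ell2 →L[ℂ] Ell2)) ⊆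
      closure (Submodule.span ℂ (Set.range fun p : ℕ × ℕ => monomial p.1 p.2)) := by
  have key : ((Submonoid.closure ({shift} ∪ star {shift}) : Submonoid (Ell2 →L[ℂ] Ell2)) :
      Set (Ell2 →L[ℂ] Ell2)) ⊆ Set.range fun p : ℕ × ℕ => monomial p.1 p.2 := by
    intro x hx
    induction hx using Submonoid.closure_induction_left with
    | one => exact ⟨(0, 0), monomial_zero_zero⟩
    | mul_left x hx y _ hy =>
      obtain ⟨⟨n, m⟩, rfl⟩ := hy
      rcases hx with hx | hx
      · rw [Set.mem_singleton_iff.1 hx]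
        exact ⟨(n + 1, m), (shift_mul_monomial n m).symm⟩
      · rw [Set.mem_star, Set.mem_singleton_iff, star_eq_iff_star_eq] at hx
        rw [← hx]
        cases n with
        | zero => exact ⟨(0, m + 1), (star_shift_mul_monomial_zero m).symm⟩
        | succ n => exact ⟨(n, m), (star_shift_mul_monomial_succ n m).symm⟩
  have h := StarAlgebra.adjoin_eq_span (R := ℂ) ({shift} : Set (Ell2 →L[ℂ] Ell2))
  change (closure (StarAlgebra.adjoin ℂ {shift} : Set (Ell2 →L[ℂ] Ell2))) ⊆ _
  refine closure_mono fun x hx => Submodule.span_mono key ?_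
  rw [← h]
  exact hx

theorem dense_span_Tmon :
    Dense (Submodule.span ℂ (Set.range fun p : ℕ × ℕ => Tmon p.1 p.2) : Set toeplitz) := by
  rw [Subtype.dense_iff]
  have : Subtype.val '' (Submodule.span ℂ (Set.range fun p : ℕ × ℕ => Tmon p.1 p.2) :
      Set toeplitz) = Submodule.span ℂ (Set.range fun p : ℕ × ℕ => monomial p.1 p.2) := by
    have := Submodule.map_span (Subalgebra.toSubmodule toeplitz.toSubalgebra).subtype
      (Set.range fun p : ℕ × ℕ => Tmon p.1 p.2)
    rw [← Set.range_comp] at this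
    exact congrArg (fun S : Submodule ℂ (Ell2 →L[ℂ] Ell2) => (S : Set (Ell2 →L[ℂ] Ell2))) this
  exact toeplitz_subset_closure_span.trans_eq (congrArg closure this.symm)

theorem toeplitz_ext {F : Type*} [NormedAddCommGroup F] [NormedSpace ℂ F]
    {f g : toeplitz →L[ℂ] F} (h : ∀ n m, f (Tmon n m) = g (Tmon n m)) : f = g :=
  ContinuousLinearMap.ext_on dense_span_Tmon (by rintro _ ⟨p, rfl⟩; exact h p.1 p.2)

/-! ### Compactness of the differences of monomials -/

theorem star_shift_stdBasis_zero : star shift (stdBasis ℕ 0) = 0 := by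
  have : innerSL ℂ (star shift (stdBasis ℕ 0)) = 0 := by
    refine hilbertBasis_ext (stdBasis ℕ) fun j => ?_
    classical
    rw [innerSL_apply_apply, ContinuousLinearMap.star_eq_adjoint,
      ContinuousLinearMap.adjoint_inner_left, shift_stdBasis,
      orthonormal_iff_ite.1 (stdBasis ℕ).orthonormal]
    simp
  exact inner_self_eq_zero.1 (DFunLike.congr_fun this (star shift (stdBasis ℕ 0)))

theorem star_shift_stdBasis_succ (n : ℕ) : star shift (stdBasis ℕ (n + 1)) = stdBasis ℕ n := by
  rw [← shift_stdBasis]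
  exact DFunLike.congr_fun star_shift_mul_shift (stdBasis ℕ n)

/-- The operator is minus the rank-one projection onto $e_0$. -/
theorem isCompactOperator_shift_mul_star_sub_one :
    IsCompactOperator (shift * star shift - 1 : Ell2 →L[ℂ] Ell2) := by
  have : (shift * star shift - 1 : Ell2 →L[ℂ] Ell2) =
      (-(ContinuousLinearMap.toSpanSingleton ℂ (stdBasis ℕ 0))) ∘L innerSL ℂ (stdBasis ℕ 0) := by
    refine hilbertBasis_ext (stdBasis ℕ) fun j => ?_
    classical
    cases j with
    | zero =>
      simp [star_shift_stdBasis_zero, (stdBasis ℕ).orthonormal.1 0]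
    | succ j =>
      have := orthonormal_iff_ite.1 (stdBasis ℕ).orthonormal 0 (j + 1)
      simp [star_shift_stdBasis_succ, shift_stdBasis, this]
  rw [this]
  have h : IsCompactOperator (innerSL ℂ (stdBasis ℕ 0)) :=
    isCompactOperator_of_locallyCompactSpace_dom _
  exact h.clm_comp (-(ContinuousLinearMap.toSpanSingleton ℂ (stdBasis ℕ 0)))

theorem isCompactOperator_shift_pow_mul_star_sub_one (n : ℕ) :
    IsCompactOperator (shift ^ n * star shift ^ n - 1 : Ell2 →L[ℂ] Ell2) := by
  induction n with
  | zero => simpa using isCompactOperator_zero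
  | succ n ih =>
    have : (shift ^ (n + 1) * star shift ^ (n + 1) - 1 : Ell2 →L[ℂ] Ell2) =
        shift * ((shift ^ n * star shift ^ n - 1) * star shift) + (shift * star shift - 1) := by
      rw [pow_succ', pow_succ]
      noncomm_ring
    rw [this]
    exact ((ih.comp_clm (star shift)).clm_comp shift).add isCompactOperator_shift_mul_star_sub_one

/-- With the next lemma: modulo compact operators, $T_{n,m}$ depends only on $m-n$. -/
theorem isCompactOperator_monomial_sub_star_pow (n d : ℕ) :
    IsCompactOperator (monomial n (n + d) - star shift ^ d) := by
  have : monomial n (n + d) - star shift ^ d =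
      (shift ^ n * star shift ^ n - 1) * star shift ^ d := by
    rw [monomial, pow_add]
    noncomm_ring
  rw [this]
  exact (isCompactOperator_shift_pow_mul_star_sub_one n).comp_clm _

theorem isCompactOperator_monomial_sub_pow (m d : ℕ) :
    IsCompactOperator (monomial (m + d) m - shift ^ d) := by
  have : monomial (m + d) m - shift ^ d =
      shift ^ d * (shift ^ m * star shift ^ m - 1) := by
    rw [monomial, add_comm, pow_add]
    noncomm_ring
  rw [this]
  exact (isCompactOperator_shift_pow_mul_star_sub_one m).clm_comp _

/-! ### Trigonometric polynomials -/

/-- The character `z ↦ z ^ k` of the circle. -/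
def circlePow (k : ℤ) : C(Circle, ℂ) := ⟨fun z => ((z ^ k : Circle) : ℂ),
  continuous_subtype_val.comp (continuous_zpow k)⟩

theorem circlePow_apply (k : ℤ) (z : Circle) : circlePow k z = (z : ℂ) ^ k := by
  simp [circlePow]

theorem circlePow_mul (j k : ℤ) : circlePow j * circlePow k = circlePow (j + k) := by
  ext z
  simp [circlePow, zpow_add]

theorem star_circlePow (k : ℤ) : star (circlePow k) = circlePow (-k) := by
  ext z
  simp [circlePow, ← Circle.coe_inv_eq_conj]

theorem circlePow_zero : circlePow 0 = 1 := by
  ext z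
  simp [circlePow]

/-- Stone–Weierstrass: $z$ separates points, and words in $z,\bar z$ are powers of $z$. -/
theorem dense_span_circlePow :
    Dense (Submodule.span ℂ (Set.range circlePow) : Set C(Circle, ℂ)) := by
  have key : ((Submonoid.closure ({circlePow 1} ∪ star {circlePow 1}) : Submonoid C(Circle, ℂ)) :
      Set C(Circle, ℂ)) ⊆ Set.range circlePow := by
    intro x hx
    induction hx using Submonoid.closure_induction with
    | one => exact ⟨0, circlePow_zero⟩
    | mul x y _ _ hx hy =>
      obtain ⟨j, rfl⟩ := hx
      obtain ⟨k, rfl⟩ := hy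
      exact ⟨j + k, (circlePow_mul j k).symm⟩
    | mem x hx =>
      rcases hx with hx | hx
      · exact ⟨1, (Set.mem_singleton_iff.1 hx).symm⟩
      · rw [Set.mem_star, Set.mem_singleton_iff, star_eq_iff_star_eq, star_circlePow] at hx
        exact ⟨_, hx⟩
  have h := StarAlgebra.adjoin_eq_span (R := ℂ) ({circlePow 1} : Set C(Circle, ℂ))
  have hsw := ContinuousMap.starSubalgebra_topologicalClosure_eq_top_of_separatesPoints
    (StarAlgebra.adjoin ℂ {circlePow 1}) (by
      intro x y hxy
      refine ⟨circlePow 1, ⟨circlePow 1, StarAlgebra.self_mem_adjoin_singleton ℂ _, rfl⟩, ?_⟩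
      simpa [circlePow_apply] using fun h => hxy (Circle.ext h))
  have hd : Dense (StarAlgebra.adjoin ℂ {circlePow 1} : Set C(Circle, ℂ)) := by
    rw [dense_iff_closure_eq, ← StarSubalgebra.topologicalClosure_coe, hsw]
    rfl
  refine hd.mono fun x hx => Submodule.span_mono key ?_
  rw [← h]
  exact hx

/-! ### The unitary dilation of the shift -/

/-- The bilateral shift `U` dilates the unilateral shift. -/
theorem exists_unitary_dilation :
    ∃ (U : unitary (lp (fun _ : ℤ => ℂ) 2 →L[ℂ] lp (fun _ : ℤ => ℂ) 2))
      (V : Ell2 →L[ℂ] lp (fun _ : ℤ => ℂ) 2),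
      ContinuousLinearMap.adjoint V ∘L V = 1 ∧
        V ∘L shift = (U : lp (fun _ : ℤ => ℂ) 2 →L[ℂ] lp (fun _ : ℤ => ℂ) 2) ∘L V := by
  classical
  let b := stdBasis ℤ
  have ho : Orthonormal ℂ fun k : ℤ => b (k + 1) :=
    b.orthonormal.comp _ (add_left_injective 1)
  have hd : (Submodule.span ℂ (Set.range fun k : ℤ => b (k + 1)))ᗮ = ⊥ := by
    have : (Set.range fun k : ℤ => b (k + 1)) = Set.range b :=
      (Equiv.addRight (1 : ℤ)).surjective.range_comp b
    rw [this, ← Submodule.orthogonal_closure, b.dense_span, Submodule.top_orthogonal_eq_bot]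
  let b' := HilbertBasis.mkOfOrthogonalEqBot ho hd
  have hb' (k : ℤ) : b' k = b (k + 1) := by
    rw [HilbertBasis.coe_mkOfOrthogonalEqBot]
  -- The translated family is again a Hilbert basis, so the map carrying one basis to the other is
  -- unitary.
  let U := b.repr.trans b'.repr.symm
  have hU (k : ℤ) : U (b k) = b (k + 1) := by
    rw [← hb']
    simp [U, HilbertBasis.repr_self]
  have hon : Orthonormal ℂ fun n : ℕ => b (n : ℤ) :=
    b.orthonormal.comp _ Nat.cast_injective
  let V := hon.orthogonalFamily.linearIsometry
  have hV (n : ℕ) : V (stdBasis ℕ n) = b (n : ℤ) := by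
    rw [← HilbertBasis.repr_symm_single]
    change V (lp.single 2 n (1 : ℂ)) = _
    rw [OrthogonalFamily.linearIsometry_apply_single]
    simp
  refine ⟨Unitary.linearIsometryEquiv.symm U, V.toContinuousLinearMap,
    (ContinuousLinearMap.norm_map_iff_adjoint_comp_self _).1 V.norm_map, ?_⟩
  refine hilbertBasis_ext (stdBasis ℕ) fun n => ?_
  change V (shift (stdBasis ℕ n)) = U (V (stdBasis ℕ n))
  rw [shift_stdBasis, hV, hV, hU]
  simp

/-- The functional calculus of a unitary operator. -/
theorem exists_circle_calculus {H : Type*} [NormedAddCommGroup H] [InnerProductSpace ℂ H]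
    [CompleteSpace H] (U : unitary (H →L[ℂ] H)) :
    ∃ Φ : C(Circle, ℂ) →⋆ₐ[ℂ] (H →L[ℂ] H), Φ (circlePow 1) = U := by
  have hn : IsStarNormal (U : H →L[ℂ] H) := inferInstance
  -- The spectrum of a unitary lies on the circle, so functions on the circle can be restricted to
  -- it.
  let j : C(spectrum ℂ (U : H →L[ℂ] H), Circle) :=
    ⟨fun x => ⟨x, by simpa [Submonoid.unitSphere] using Unitary.spectrum_subset_circle U x.2⟩,
      by fun_prop⟩
  refine ⟨(cfcHom hn).comp (ContinuousMap.compStarAlgHom' ℂ ℂ j), ?_⟩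
  have : ContinuousMap.compStarAlgHom' ℂ ℂ j (circlePow 1) =
      (ContinuousMap.id ℂ).restrict (spectrum ℂ (U : H →L[ℂ] H)) := by
    ext x
    rw [ContinuousMap.compStarAlgHom'_apply, ContinuousMap.comp_apply, circlePow_apply, zpow_one]
    rfl
  rw [StarAlgHom.comp_apply, this]
  exact cfcHom_id hn

/-- Trigonometric polynomials lift to Toeplitz operators of at most the same norm, up to compact
operators. -/
theorem exists_contractive_lift :
    ∃ L : C(Circle, ℂ) →ₗ[ℂ] (Ell2 →L[ℂ] Ell2), (∀ f, ‖L f‖ ≤ ‖f‖) ∧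
      (∀ k, L (circlePow k) ∈ toeplitz) ∧
      ∀ n m : ℕ, IsCompactOperator (monomial n m - L (circlePow ((m : ℤ) - n))) := by
  obtain ⟨U, V, hV, hUV⟩ := exists_unitary_dilation
  -- The adjoint is used because $T=T_{1,0}$ has symbol $z^{-1}$.
  obtain ⟨Φ, hΦ⟩ := exists_circle_calculus (star U)
  have hVn : ‖V‖ ≤ 1 := ContinuousLinearMap.opNorm_le_bound _ zero_le_one fun x => by
    rw [(ContinuousLinearMap.norm_map_iff_adjoint_comp_self V).2 hV, one_mul]
  have hVn' : ‖ContinuousLinearMap.adjoint V‖ ≤ 1 := by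
    rwa [LinearIsometryEquiv.norm_map]
  let L : C(Circle, ℂ) →ₗ[ℂ] (Ell2 →L[ℂ] Ell2) :=
    { toFun := fun f => ContinuousLinearMap.adjoint V ∘L Φ f ∘L V
      map_add' := fun f g => by
        simp [ContinuousLinearMap.add_comp, ContinuousLinearMap.comp_add]
      map_smul' := fun c f => by
        simp [ContinuousLinearMap.smul_comp] }
  have hL (f) : L f = ContinuousLinearMap.adjoint V ∘L Φ f ∘L V := rfl
  have hpow (d : ℕ) : L (circlePow (-(d : ℤ))) = shift ^ d := by
    have h1 : Φ (circlePow (-1)) = U := by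
      rw [← star_circlePow, map_star, hΦ]
      simp
    have h2 : circlePow (-(d : ℤ)) = circlePow (-1) ^ d := by
      ext z
      simp [circlePow]
    -- Iterating $VT=UV$ gives $V^*U^dV=V^*VT^d=T^d$.
    have h3 (d : ℕ) : ((U : _ →L[ℂ] _) ^ d) ∘L V = V ∘L (shift ^ d) := by
      induction d with
      | zero => rfl
      | succ d ih =>
        rw [pow_succ, pow_succ', ContinuousLinearMap.mul_def, ContinuousLinearMap.comp_assoc,
          ← hUV, ← ContinuousLinearMap.comp_assoc, ih]
        rw [← pow_succ', pow_succ]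
        rfl
    rw [hL, h2, map_pow, h1, h3, ← ContinuousLinearMap.comp_assoc, hV]
    rfl
  have hstar (f) : L (star f) = star (L f) := by
    rw [hL, hL, map_star, ContinuousLinearMap.star_eq_adjoint, ContinuousLinearMap.star_eq_adjoint,
      ContinuousLinearMap.adjoint_comp, ContinuousLinearMap.adjoint_comp,
      ContinuousLinearMap.adjoint_adjoint, ContinuousLinearMap.comp_assoc]
  have hpow' (d : ℕ) : L (circlePow d) = star shift ^ d := by
    rw [← star_pow, ← hpow, ← hstar, star_circlePow, neg_neg]
  refine ⟨L, fun f => ?_, fun k => ?_, fun n m => ?_⟩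
  · rw [hL]
    have h1 := NonUnitalStarAlgHom.norm_apply_le Φ f
    calc _ ≤ ‖ContinuousLinearMap.adjoint V‖ * (‖Φ f‖ * ‖V‖) :=
          (ContinuousLinearMap.opNorm_comp_le _ _).trans
            (mul_le_mul_of_nonneg_left (ContinuousLinearMap.opNorm_comp_le _ _) (norm_nonneg _))
      _ ≤ 1 * (‖f‖ * 1) := by gcongr
      _ = ‖f‖ := by ring
  · obtain ⟨d, rfl | rfl⟩ := k.eq_nat_or_neg
    · rw [hpow']
      exact pow_mem (star_mem shift_mem) d
    · rw [hpow]
      exact pow_mem shift_mem d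
  · rcases le_total n m with h | h
    · obtain ⟨d, rfl⟩ := Nat.exists_eq_add_of_le h
      have : ((n + d : ℕ) : ℤ) - n = d := by push_cast; ring
      rw [this, hpow']
      exact isCompactOperator_monomial_sub_star_pow n d
    · obtain ⟨d, rfl⟩ := Nat.exists_eq_add_of_le h
      have : (m : ℤ) - ((m + d : ℕ) : ℤ) = -d := by push_cast; ring
      rw [this, hpow]
      exact isCompactOperator_monomial_sub_pow m d

/-! ### Approximate eigenvectors of the shift -/

/-- The unit vector `(N + 1)^(-1/2) ∑ k ≤ N, z ^ k e_k`. -/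
def approxEigenvector (z : Circle) (N : ℕ) : Ell2 :=
  ((√(N + 1 : ℝ))⁻¹ : ℂ) • ∑ k ∈ Finset.range (N + 1), ((z : ℂ) ^ k) • stdBasis ℕ k

theorem norm_approxEigenvector (z : Circle) (N : ℕ) : ‖approxEigenvector z N‖ = 1 := by
  have h : ‖∑ k ∈ Finset.range (N + 1), ((z : ℂ) ^ k) • stdBasis ℕ k‖ ^ 2 = (N + 1 : ℝ) := by
    have h := (stdBasis ℕ).orthonormal.inner_sum (fun k => (z : ℂ) ^ k) (fun k => (z : ℂ) ^ k)
      (Finset.range (N + 1))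
    rw [inner_self_eq_norm_sq_to_K] at h
    have h1 (k : ℕ) : (starRingEnd ℂ) ((z : ℂ) ^ k) * (z : ℂ) ^ k = 1 := by
      rw [← Complex.normSq_eq_conj_mul_self, Complex.normSq_eq_norm_sq, norm_pow, Circle.norm_coe]
      simp
    simp only [h1, Finset.sum_const, Finset.card_range, nsmul_eq_mul, mul_one] at h
    refine Complex.ofReal_injective ?_
    rw [Complex.ofReal_pow]
    exact h.trans (by push_cast; rfl)
  have h2 : ‖∑ k ∈ Finset.range (N + 1), ((z : ℂ) ^ k) • stdBasis ℕ k‖ = √(N + 1 : ℝ) := by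
    rw [← h, Real.sqrt_sq (norm_nonneg _)]
  rw [approxEigenvector, norm_smul, h2, norm_inv, Complex.norm_real, Real.norm_of_nonneg (by positivity)]
  exact inv_mul_cancel₀ (by positivity)

theorem tendsto_inv_sqrt : Tendsto (fun N : ℕ => (√(N + 1 : ℝ))⁻¹) atTop (𝓝 0) := by
  refine tendsto_inv_atTop_zero.comp (Real.tendsto_sqrt_atTop.comp ?_)
  exact tendsto_atTop_add_const_right _ _ tendsto_natCast_atTop_atTop

/-- Away from the two ends of the sum, shifting multiplies the coefficients by $z^{-1}$. The two end
terms have total norm at most $2/\sqrt{N+1}$. -/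
theorem tendsto_shift_approxEigenvector (z : Circle) :
    Tendsto (fun N => shift (approxEigenvector z N) - (z : ℂ)⁻¹ • approxEigenvector z N) atTop
      (𝓝 0) := by
  have hz : (z : ℂ) ≠ 0 := Circle.coe_ne_zero z
  have key (N : ℕ) : shift (approxEigenvector z N) - (z : ℂ)⁻¹ • approxEigenvector z N =
      ((√(N + 1 : ℝ))⁻¹ : ℂ) • ((z : ℂ) ^ N • stdBasis ℕ (N + 1) - (z : ℂ)⁻¹ • stdBasis ℕ 0) := by
    rw [approxEigenvector, map_smul, smul_comm (z : ℂ)⁻¹, ← smul_sub]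
    congr 1
    induction N with
    | zero => simp [shift_stdBasis]
    | succ N ih =>
      rw [Finset.sum_range_succ, map_add, smul_add, add_sub_add_comm, ih, map_smul, shift_stdBasis,
        smul_smul, pow_succ', inv_mul_cancel_left₀ hz]
      abel
  refine squeeze_zero_norm (a := fun N : ℕ => (√(N + 1 : ℝ))⁻¹ * 2) (fun N => ?_)
    (by simpa using tendsto_inv_sqrt.mul_const 2)
  rw [key, norm_smul, norm_inv, Complex.norm_real, Real.norm_of_nonneg (by positivity)]
  gcongr
  refine (norm_sub_le _ _).trans ?_
  rw [norm_smul, norm_smul, (stdBasis ℕ).orthonormal.1, (stdBasis ℕ).orthonormal.1]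
  rw [norm_pow, norm_inv, Circle.norm_coe]
  norm_num

theorem tendsto_monomial_approxEigenvector (z : Circle) (n m : ℕ) :
    Tendsto (fun N => monomial n m (approxEigenvector z N) -
      ((z : ℂ) ^ ((m : ℤ) - n)) • approxEigenvector z N) atTop (𝓝 0) := by
  have hz : (z : ℂ) ≠ 0 := Circle.coe_ne_zero z
  have hT := tendsto_shift_approxEigenvector z
  have hS : Tendsto (fun N => star shift (approxEigenvector z N) -
      (z : ℂ) • approxEigenvector z N) atTop (𝓝 0) := by
    -- Applying $-zT^*$ to $Tv_N-z^{-1}v_N\to0$ and using $T^*T=1$ gives the eigenvalue $z$ for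
    -- $T^*$.
    have := (((star shift).continuous.tendsto 0).comp hT).const_smul (-(z : ℂ))
    rw [map_zero, smul_zero] at this
    refine this.congr fun N => ?_
    have h1 : star shift (shift (approxEigenvector z N)) = approxEigenvector z N :=
      DFunLike.congr_fun star_shift_mul_shift _
    simp only [Function.comp_apply, map_sub, map_smul, h1, smul_sub, smul_smul]
    rw [neg_mul, mul_inv_cancel₀ hz]
    module
  have step (A B : Ell2 →L[ℂ] Ell2) (a b : ℂ)
      (hA : Tendsto (fun N => A (approxEigenvector z N) - a • approxEigenvector z N) atTop (𝓝 0))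
      (hB : Tendsto (fun N => B (approxEigenvector z N) - b • approxEigenvector z N) atTop (𝓝 0)) :
      Tendsto (fun N => (A * B) (approxEigenvector z N) - (a * b) • approxEigenvector z N) atTop
        (𝓝 0) := by
    have := ((A.continuous.tendsto 0).comp hB).add (hA.const_smul b)
    rw [map_zero, smul_zero, add_zero] at this
    refine this.congr fun N => ?_
    simp only [Function.comp_apply, map_sub, map_smul, mul_apply_eq_comp]
    module
  induction n with
  | zero =>
    induction m with
    | zero => simp [monomial_zero_zero]
    | succ m ih =>
      rw [← star_shift_mul_monomial_zero]
      convert step _ _ _ _ hS ih using 5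
      rw [← zpow_one_add₀ hz]
      congr 1
      push_cast
      ring
  | succ n ih =>
    rw [← shift_mul_monomial]
    convert step _ _ _ _ hT ih using 5
    rw [← zpow_neg_one, ← zpow_add₀ hz]
    congr 1
    push_cast
    ring

/-- Each coefficient is 0 or has modulus $(N+1)^{-1/2}$. -/
theorem tendsto_inner_approxEigenvector_stdBasis (z : Circle) (j : ℕ) :
    Tendsto (fun N => ⟪approxEigenvector z N, stdBasis ℕ j⟫_ℂ) atTop (𝓝 0) := by
  refine squeeze_zero_norm (fun N => ?_) tendsto_inv_sqrt
  classical
  rw [approxEigenvector, inner_smul_left, sum_inner, norm_mul, RCLike.norm_conj, norm_inv,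
    Complex.norm_real, Real.norm_of_nonneg (by positivity)]
  refine mul_le_of_le_one_right (by positivity) ?_
  simp only [inner_smul_left, orthonormal_iff_ite.1 (stdBasis ℕ).orthonormal, mul_ite, mul_one,
    mul_zero, Finset.sum_ite_eq']
  split_ifs <;> simp [Circle.norm_coe]

/-- Bounded sequences with vanishing coefficients in a Hilbert basis are asymptotically in the
kernel of compact operators. -/
theorem tendsto_inner_compact {ι H : Type*} [NormedAddCommGroup H] [InnerProductSpace ℂ H]
    [CompleteSpace H] (b : HilbertBasis ι ℂ H) {v : ℕ → H} (hv : ∀ N, ‖v N‖ ≤ 1)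
    (hb : ∀ i, Tendsto (fun N => ⟪v N, b i⟫_ℂ) atTop (𝓝 0)) {A : H →L[ℂ] H}
    (hA : IsCompactOperator A) : Tendsto (fun N => ⟪v N, A (v N)⟫_ℂ) atTop (𝓝 0) := by
  have hspan : ∀ x ∈ Submodule.span ℂ (Set.range b),
      Tendsto (fun N => ⟪v N, x⟫_ℂ) atTop (𝓝 0) := by
    intro x hx
    induction hx using Submodule.span_induction with
    | mem x hx => obtain ⟨i, rfl⟩ := hx; exact hb i
    | zero => simp
    | add x y _ _ hx hy => simpa [inner_add_right] using hx.add hy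
    | smul c x _ hx => simpa [inner_smul_right] using hx.const_mul c
  have hdense : Dense (Submodule.span ℂ (Set.range b) : Set H) :=
    Submodule.dense_iff_topologicalClosure_eq_top.2 b.dense_span
  obtain ⟨C, hC, hAC⟩ := hA.image_closedBall_subset_compact 1
  rw [Metric.tendsto_atTop]
  intro ε hε
  -- Finitely many balls centred in the span of the basis cover the image of the unit ball, which
  -- makes the weak convergence uniform there.
  obtain ⟨t, ht⟩ := hC.elim_finite_subcover
    (fun x : Submodule.span ℂ (Set.range b) => Metric.ball (x : H) (ε / 2))
    (fun _ => Metric.isOpen_ball) (fun y _ => by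
      obtain ⟨x, hx, hxy⟩ := hdense.exists_dist_lt y (half_pos hε)
      exact Set.mem_iUnion.2 ⟨⟨x, hx⟩, hxy⟩)
  have hev : ∀ᶠ N in atTop, ∀ x ∈ t, ‖⟪v N, (x : H)⟫_ℂ‖ < ε / 2 := by
    rw [Filter.eventually_all_finset]
    intro x _
    have := (hspan x x.2).norm
    rw [norm_zero] at this
    exact this.eventually_lt_const (half_pos hε)
  obtain ⟨N₀, hN₀⟩ := eventually_atTop.1 hev
  refine ⟨N₀, fun N hN => ?_⟩
  have hmem : A (v N) ∈ C := hAC ⟨v N, by simpa using hv N, rfl⟩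
  obtain ⟨x, hx⟩ := Set.mem_iUnion.1 (ht hmem)
  obtain ⟨hxt, hx⟩ := Set.mem_iUnion.1 hx
  rw [dist_zero_right]
  have h1 : ⟪v N, A (v N)⟫_ℂ = ⟪v N, (x : H)⟫_ℂ + ⟪v N, A (v N) - x⟫_ℂ := by
    rw [← inner_add_right, add_sub_cancel]
  have h2 : ‖⟪v N, A (v N) - x⟫_ℂ‖ ≤ ‖A (v N) - x‖ :=
    (norm_inner_le_norm _ _).trans (mul_le_of_le_one_left (norm_nonneg _) (hv N))
  rw [Metric.mem_ball, dist_eq_norm] at hx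
  rw [h1]
  refine (norm_add_le _ _).trans_lt ?_
  have := hN₀ N hN x hxt
  linarith

/-! ### The quotient by the compact operators -/

theorem isClosed_compacts : IsClosed (compacts : Set toeplitz) :=
  (isClosed_setOfPred_isCompactOperator (σ₁₂ := RingHom.id ℂ) (M₁ := Ell2) (M₂ := Ell2)).preimage
    continuous_subtype_val

/-- The linear combination of the operators `T_{n,m}` with given coefficients. -/
def combTmon : (ℕ × ℕ →₀ ℂ) →ₗ[ℂ] toeplitz :=
  Finsupp.linearCombination ℂ fun p : ℕ × ℕ => Tmon p.1 p.2

/-- The symbol of a linear combination of the operators `T_{n,m}`. -/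
def combSymbol : (ℕ × ℕ →₀ ℂ) →ₗ[ℂ] C(Circle, ℂ) :=
  Finsupp.linearCombination ℂ fun p : ℕ × ℕ => circlePow ((p.2 : ℤ) - p.1)

theorem denseRange_combTmon : DenseRange combTmon := by
  have h := Finsupp.range_linearCombination (R := ℂ) (v := fun p : ℕ × ℕ => Tmon p.1 p.2)
  have h2 := dense_span_Tmon
  rw [← h] at h2
  exact h2

theorem denseRange_combSymbol : DenseRange combSymbol := by
  have h := Finsupp.range_linearCombination (R := ℂ)
    (v := fun p : ℕ × ℕ => circlePow ((p.2 : ℤ) - p.1))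
  have h2 := dense_span_circlePow
  have h3 : (Set.range fun p : ℕ × ℕ => circlePow ((p.2 : ℤ) - p.1)) = Set.range circlePow := by
    refine Set.Subset.antisymm (Set.range_subset_iff.2 fun p => ⟨_, rfl⟩)
      (Set.range_subset_iff.2 fun k => ⟨((-k).toNat, k.toNat), ?_⟩)
    exact congrArg circlePow (Int.toNat_sub_toNat_neg k)
  rw [← h3, ← h] at h2
  exact h2

theorem tendsto_combTmon_approxEigenvector (z : Circle) (x : ℕ × ℕ →₀ ℂ) :
    Tendsto (fun N => (combTmon x : Ell2 →L[ℂ] Ell2) (approxEigenvector z N) -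
      combSymbol x z • approxEigenvector z N) atTop (𝓝 0) := by
  induction x using Finsupp.induction_linear with
  | zero => simp
  | add x y hx hy =>
    have := hx.add hy
    rw [add_zero] at this
    refine this.congr fun N => ?_
    rw [map_add, map_add]
    change _ = ((combTmon x : Ell2 →L[ℂ] Ell2) (approxEigenvector z N) +
      (combTmon y : Ell2 →L[ℂ] Ell2) (approxEigenvector z N)) -
      (combSymbol x z + combSymbol y z) • approxEigenvector z N
    module
  | single p c =>
    have := (tendsto_monomial_approxEigenvector z p.1 p.2).const_smul c
    rw [smul_zero] at this
    refine this.congr fun N => ?_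
    rw [combTmon, combSymbol, Finsupp.linearCombination_single, Finsupp.linearCombination_single]
    change _ = c • (monomial p.1 p.2) (approxEigenvector z N) -
      (c * circlePow _ z) • approxEigenvector z N
    rw [circlePow_apply]
    module

/-- The symbol at $z$ is the limit of $\langle v_N,(x+K)v_N\rangle$, since the compact term vanishes
in the limit. -/
theorem norm_combSymbol_le_of_isCompactOperator (x : ℕ × ℕ →₀ ℂ) {K : Ell2 →L[ℂ] Ell2}
    (hK : IsCompactOperator K) : ‖combSymbol x‖ ≤ ‖(combTmon x : Ell2 →L[ℂ] Ell2) + K‖ := by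
  refine (ContinuousMap.norm_le _ (norm_nonneg _)).2 fun z => ?_
  have h1 : Tendsto (fun N => ⟪approxEigenvector z N, (combTmon x : Ell2 →L[ℂ] Ell2)
      (approxEigenvector z N) - combSymbol x z • approxEigenvector z N⟫_ℂ) atTop (𝓝 0) := by
    refine squeeze_zero_norm (fun N => ?_) (tendsto_zero_iff_norm_tendsto_zero.1
      (tendsto_combTmon_approxEigenvector z x))
    refine (norm_inner_le_norm _ _).trans ?_
    rw [norm_approxEigenvector, one_mul]
  have h2 := tendsto_inner_compact (stdBasis ℕ) (fun N => (norm_approxEigenvector z N).le)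
    (tendsto_inner_approxEigenvector_stdBasis z) hK
  have h3 := (h1.add h2).add_const (combSymbol x z)
  simp only [zero_add, add_zero] at h3
  refine le_of_tendsto h3.norm (Eventually.of_forall fun N => ?_)
  have h4 : ⟪approxEigenvector z N, (combTmon x : Ell2 →L[ℂ] Ell2) (approxEigenvector z N) -
      combSymbol x z • approxEigenvector z N⟫_ℂ + ⟪approxEigenvector z N,
      K (approxEigenvector z N)⟫_ℂ + combSymbol x z = ⟪approxEigenvector z N,
        ((combTmon x : Ell2 →L[ℂ] Ell2) + K) (approxEigenvector z N)⟫_ℂ := by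
    rw [inner_sub_right, inner_smul_right, inner_self_eq_norm_sq_to_K, norm_approxEigenvector,
      add_apply, inner_add_right]
    simp only [RCLike.ofReal_one, one_pow, mul_one]
    ring
  rw [h4]
  refine (norm_inner_le_norm _ _).trans ?_
  have := ((combTmon x : Ell2 →L[ℂ] Ell2) + K).le_opNorm (approxEigenvector z N)
  rw [norm_approxEigenvector, mul_one] at this
  rwa [norm_approxEigenvector, one_mul]

/-- The equality is stated on coefficient families, so it also shows that the symbol depends only on
the class in the quotient. -/
theorem norm_mk_combTmon (x : ℕ × ℕ →₀ ℂ) :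
    ‖combSymbol x‖ = ‖compacts.mkQ (combTmon x)‖ := by
  apply le_antisymm
  · refine le_of_forall_pos_le_add fun ε hε => ?_
    obtain ⟨B, hB, hlt⟩ := Submodule.Quotient.norm_mk_lt (compacts.mkQ (combTmon x)) hε
    have hK : B - combTmon x ∈ compacts := (Submodule.Quotient.eq compacts).1 hB
    have h := norm_combSymbol_le_of_isCompactOperator x (K := (B - combTmon x : toeplitz)) hK
    have h2 : (combTmon x : Ell2 →L[ℂ] Ell2) + (B - combTmon x : toeplitz) = B := by
      simp
    rw [h2] at h
    exact h.trans hlt.le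
  · obtain ⟨L, hL, hLmem, hLc⟩ := exists_contractive_lift
    -- The compressed operator must lie in $\mathcal T$ to represent the same class; its norm then
    -- bounds the quotient norm.
    have hc : IsCompactOperator ((combTmon x : Ell2 →L[ℂ] Ell2) - L (combSymbol x)) ∧
        L (combSymbol x) ∈ toeplitz := by
      induction x using Finsupp.induction_linear with
      | zero => simpa using isCompactOperator_zero
      | add x y hx hy =>
        rw [map_add, map_add, map_add]
        refine ⟨?_, add_mem hx.2 hy.2⟩
        have h : ((combTmon x + combTmon y : toeplitz) : Ell2 →L[ℂ] Ell2) -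
            (L (combSymbol x) + L (combSymbol y)) = (combTmon x - L (combSymbol x)) +
              (combTmon y - L (combSymbol y)) := add_sub_add_comm _ _ _ _
        rw [h]
        exact hx.1.add hy.1
      | single p c =>
        rw [combTmon, combSymbol, Finsupp.linearCombination_single,
          Finsupp.linearCombination_single, map_smul]
        refine ⟨?_, Subalgebra.smul_mem _ (hLmem _) c⟩
        have h : ((c • Tmon p.1 p.2 : toeplitz) : Ell2 →L[ℂ] Ell2) -
            c • L (circlePow ((p.2 : ℤ) - p.1)) =
              c • (monomial p.1 p.2 - L (circlePow ((p.2 : ℤ) - p.1))) := (smul_sub _ _ _).symm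
        rw [h]
        exact (hLc p.1 p.2).smul c
    have h : compacts.mkQ (combTmon x) = compacts.mkQ ⟨L (combSymbol x), hc.2⟩ :=
      (Submodule.Quotient.eq compacts).2 hc.1
    rw [h]
    exact (Submodule.Quotient.norm_mk_le compacts _).trans (hL _)

/-- The symbol map induces an isometry of `𝒯/𝒦` onto `C(S¹)`. -/
theorem exists_quotient_isometry :
    ∃ π : (toeplitz ⧸ compacts) ≃ₗᵢ[ℂ] C(Circle, ℂ),
      ∀ n m : ℕ, π (compacts.mkQ (Tmon n m)) = circlePow ((m : ℤ) - n) := by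
  have hc : IsClosed (compacts : Set toeplitz) := isClosed_compacts
  have ht : IsClosed (toeplitz : Set (Ell2 →L[ℂ] Ell2)) := isClosed_toeplitz
  have : CompleteSpace toeplitz := ht.completeSpace_coe
  have hd : DenseRange (compacts.mkQ ∘ₗ combTmon) :=
    (compacts.mkQ_surjective).denseRange.comp denseRange_combTmon compacts.mkQL.continuous
  -- Two linear maps from the coefficient space with dense ranges and equal norms induce an isometry
  -- between the complete targets.
  refine ⟨LinearEquiv.extendOfIsometry (LinearEquiv.refl ℂ (ℕ × ℕ →₀ ℂ)) (compacts.mkQ ∘ₗ combTmon)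
    combSymbol hd denseRange_combSymbol norm_mk_combTmon, fun n m => ?_⟩
  have h := LinearEquiv.extendOfIsometry_eq (LinearEquiv.refl ℂ (ℕ × ℕ →₀ ℂ))
    (compacts.mkQ ∘ₗ combTmon) combSymbol hd denseRange_combSymbol norm_mk_combTmon
    (Finsupp.single (n, m) 1)
  simpa [combTmon, combSymbol] using h

/-- An isometry of `𝒯/𝒦` onto `C(S¹)` with the right values on the `T_{n,m}` is multiplicative. -/
theorem quotient_isometry_mul {p : toeplitz →L[ℂ] C(Circle, ℂ)}
    (hp : ∀ n m : ℕ, p (Tmon n m) = circlePow ((m : ℤ) - n)) (A B : toeplitz) :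
    p (A * B) = p A * p B := by
  -- For the generators $T$ and $T^*$, multiplicativity is checked on monomials $B$ and extended by
  -- density. Induction then gives all monomials on the left, and density gives all $A$.
  have hT (B : toeplitz) : p (T * B) = circlePow (-1) * p B := by
    have : p ∘L ContinuousLinearMap.mul ℂ toeplitz T =
        ContinuousLinearMap.mul ℂ C(Circle, ℂ) (circlePow (-1)) ∘L p := by
      refine toeplitz_ext fun n m => ?_
      have h1 : T * Tmon n m = Tmon (n + 1) m := Subtype.ext (shift_mul_monomial n m)
      simp only [ContinuousLinearMap.comp_apply, ContinuousLinearMap.mul_apply']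
      rw [h1, hp, hp, circlePow_mul]
      congr 1
      push_cast
      ring
    exact DFunLike.congr_fun this B
  have hS (B : toeplitz) : p (star T * B) = circlePow 1 * p B := by
    have : p ∘L ContinuousLinearMap.mul ℂ toeplitz (star T) =
        ContinuousLinearMap.mul ℂ C(Circle, ℂ) (circlePow 1) ∘L p := by
      refine toeplitz_ext fun n m => ?_
      simp only [ContinuousLinearMap.comp_apply, ContinuousLinearMap.mul_apply']
      cases n with
      | zero =>
        have h1 : star T * Tmon 0 m = Tmon 0 (m + 1) := Subtype.ext (star_shift_mul_monomial_zero m)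
        rw [h1, hp, hp, circlePow_mul]
        congr 1
        push_cast
        ring
      | succ n =>
        have h1 : star T * Tmon (n + 1) m = Tmon n m :=
          Subtype.ext (star_shift_mul_monomial_succ n m)
        rw [h1, hp, hp, circlePow_mul]
        congr 1
        push_cast
        ring
    exact DFunLike.congr_fun this B
  have hmon (n m : ℕ) (B : toeplitz) : p (Tmon n m * B) = p (Tmon n m) * p B := by
    rw [hp]
    induction n with
    | zero =>
      induction m with
      | zero =>
        have h1 : Tmon 0 0 = 1 := Subtype.ext monomial_zero_zero
        rw [h1, one_mul]
        simp [circlePow_zero]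
      | succ m ih =>
        have h1 : Tmon 0 (m + 1) = star T * Tmon 0 m :=
          Subtype.ext (star_shift_mul_monomial_zero m).symm
        rw [h1, mul_assoc, hS, ih, ← mul_assoc, circlePow_mul]
        congr 2
        push_cast
        ring
    | succ n ih =>
      have h1 : Tmon (n + 1) m = T * Tmon n m := Subtype.ext (shift_mul_monomial n m).symm
      rw [h1, mul_assoc, hT, ih, ← mul_assoc, circlePow_mul]
      congr 2
      push_cast
      ring
  have : p ∘L (ContinuousLinearMap.mul ℂ toeplitz).flip B =
      (ContinuousLinearMap.mul ℂ C(Circle, ℂ)).flip (p B) ∘L p :=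
    toeplitz_ext fun n m => hmon n m B
  exact DFunLike.congr_fun this A

theorem quotient_isometry_star {p : toeplitz →L[ℂ] C(Circle, ℂ)}
    (hp : ∀ n m : ℕ, p (Tmon n m) = circlePow ((m : ℤ) - n)) (A : toeplitz) :
    p (star A) = star (p A) := by
  refine dense_span_Tmon.induction (P := fun A => p (star A) = star (p A)) (fun x hx => ?_)
    (isClosed_eq (by fun_prop) (by fun_prop)) A
  induction hx using Submodule.span_induction with
  | mem x hx =>
    obtain ⟨⟨n, m⟩, rfl⟩ := hx
    have h1 : star (Tmon n m) = Tmon m n := Subtype.ext (star_monomial n m)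
    dsimp only
    rw [h1, hp, hp, star_circlePow]
    congr 1
    ring
  | zero => simp
  | add x y _ _ hx hy => rw [star_add, map_add, map_add, star_add, hx, hy]
  | smul c x _ hx => rw [star_smul, map_smul, map_smul, star_smul, hx]

/-- The dual of a quotient by a subspace is isometric to the annihilator of the subspace. -/
theorem exists_dual_quotient_isometry {E : Type*} [NormedAddCommGroup E] [NormedSpace ℂ E]
    (S : Submodule ℂ E) (N : Submodule ℂ (StrongDual ℂ E))
    (hN : ∀ ρ, ρ ∈ N ↔ ∀ A ∈ S, ρ A = 0) :
    ∃ π : StrongDual ℂ (E ⧸ S) ≃ₗᵢ[ℂ] N,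
      ∀ (φ : StrongDual ℂ (E ⧸ S)) (A : E), (π φ : StrongDual ℂ E) A = φ (S.mkQ A) := by
  have hmem (φ : StrongDual ℂ (E ⧸ S)) : φ ∘L S.mkQL ∈ N := by
    refine (hN _).2 fun A hA => ?_
    have : S.mkQL A = 0 := (Submodule.Quotient.mk_eq_zero S).2 hA
    rw [ContinuousLinearMap.comp_apply, this, map_zero]
  have hnorm (φ : StrongDual ℂ (E ⧸ S)) : ‖φ ∘L S.mkQL‖ = ‖φ‖ := by
    apply le_antisymm
    · refine ContinuousLinearMap.opNorm_le_bound _ (ContinuousLinearMap.opNorm_nonneg _) fun A => ?_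
      refine (φ.le_opNorm _).trans ?_
      gcongr
      exact Submodule.Quotient.norm_mk_le S A
    · refine ContinuousLinearMap.opNorm_le_bound _ (ContinuousLinearMap.opNorm_nonneg _) fun x => ?_
      refine le_of_forall_pos_le_add fun ε hε => ?_
      obtain ⟨δ, hδ, hδε⟩ : ∃ δ > 0, ‖φ ∘L S.mkQL‖ * δ ≤ ε := by
        refine ⟨ε / (‖φ ∘L S.mkQL‖ + 1), by positivity, ?_⟩
        rw [← mul_div_assoc, div_le_iff₀ (by positivity)]
        nlinarith [norm_nonneg (φ ∘L S.mkQL)]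
      -- A representative of almost minimal norm shows that passing to the quotient does not
      -- increase the norm of $\varphi$.
      obtain ⟨A, rfl, hA⟩ := Submodule.Quotient.norm_mk_lt x hδ
      calc ‖φ (Submodule.Quotient.mk A)‖ ≤ ‖φ ∘L S.mkQL‖ * ‖A‖ := (φ ∘L S.mkQL).le_opNorm A
        _ ≤ ‖φ ∘L S.mkQL‖ * (‖(Submodule.Quotient.mk A : E ⧸ S)‖ + δ) := by gcongr
        _ ≤ _ := by rw [mul_add]; gcongr
  let P : StrongDual ℂ (E ⧸ S) ≃ₗ[ℂ] N :=
    { toFun := fun φ => ⟨φ ∘L S.mkQL, hmem φ⟩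
      map_add' := fun φ ψ => rfl
      map_smul' := fun c φ => rfl
      invFun := fun ρ => S.liftQL ρ.1 ((hN ρ.1).1 ρ.2)
      left_inv := fun φ => ContinuousLinearMap.ext fun x => by
        induction x using Submodule.Quotient.induction_on
        rfl
      right_inv := fun ρ => Subtype.ext (ContinuousLinearMap.ext fun A => rfl) }
  exact ⟨⟨P, hnorm⟩, fun φ A => rfl⟩

/-- A linear isometry of normed spaces induces a linear isometry of their dual spaces. -/
theorem exists_dual_congr {E F : Type*} [SeminormedAddCommGroup E] [NormedSpace ℂ E]
    [SeminormedAddCommGroup F] [NormedSpace ℂ F] (π : E ≃ₗᵢ[ℂ] F) :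
    ∃ C : StrongDual ℂ F ≃ₗ[ℂ] StrongDual ℂ E,
      (∀ φ x, C φ x = φ (π x)) ∧ ∀ φ, ‖C φ‖ = ‖φ‖ := by
  let C : StrongDual ℂ F ≃ₗ[ℂ] StrongDual ℂ E :=
    { toFun := fun φ => φ ∘L (π.toContinuousLinearEquiv : E →L[ℂ] F)
      invFun := fun φ => φ ∘L (π.symm.toContinuousLinearEquiv : F →L[ℂ] E)
      map_add' := fun φ ψ => rfl
      map_smul' := fun c φ => rfl
      left_inv := fun φ => ContinuousLinearMap.ext fun f => congrArg φ (π.apply_symm_apply f)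
      right_inv := fun φ => ContinuousLinearMap.ext fun x => congrArg φ (π.symm_apply_apply x) }
  refine ⟨C, fun φ x => rfl, fun φ => le_antisymm ?_ ?_⟩
  · refine ContinuousLinearMap.opNorm_le_bound _ (ContinuousLinearMap.opNorm_nonneg _) fun x => ?_
    rw [← π.norm_map x]
    exact φ.le_opNorm (π x)
  · refine ContinuousLinearMap.opNorm_le_bound _ (ContinuousLinearMap.opNorm_nonneg _) fun y => ?_
    obtain ⟨x, rfl⟩ := π.surjective y
    rw [π.norm_map x]
    exact (C φ).le_opNorm x

/-! ### The duality with measures -/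

theorem norm_cintegral_le (μ : ComplexMeasure Circle) (f : C(Circle, ℂ)) :
    ‖cintegral μ f‖ ≤ totalVariationNorm μ * ‖f‖ := by
  have h := VectorMeasure.norm_integral_le_of_norm_le_const (μ := μ)
    (B := ContinuousLinearMap.mul ℝ ℂ) (f := f) (C := ‖f‖)
    (Eventually.of_forall fun x => f.norm_coe_le_norm x)
  rw [ContinuousLinearMap.opNorm_mul, mul_one, mul_comm] at h
  exact h

theorem integrable_continuousMap (μ : ComplexMeasure Circle) (f : C(Circle, ℂ)) : μ.Integrable f :=
  f.continuous.integrable_of_hasCompactSupport (HasCompactSupport.of_compactSpace f)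

/-- The **Riesz representation theorem** for the circle: `M(S¹)` is the dual space of `C(S¹)`. -/
theorem exists_riesz_equiv :
    ∃ R : ComplexMeasure Circle ≃ₗ[ℂ] StrongDual ℂ C(Circle, ℂ),
      (∀ μ f, R μ f = cintegral μ f) ∧ ∀ μ, ‖R μ‖ = totalVariationNorm μ := by
  let D (μ : ComplexMeasure Circle) : StrongDual ℂ C(Circle, ℂ) :=
    LinearMap.mkContinuous
      { toFun := fun f => cintegral μ f
        map_add' := fun f g => VectorMeasure.integral_add (integrable_continuousMap μ f)
          (integrable_continuousMap μ g)
        map_smul' := fun c f => integral_const_mul_complexMeasure μ c f }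
      (totalVariationNorm μ) (norm_cintegral_le μ)
  let D' : ComplexMeasure Circle →ₗ[ℂ] StrongDual ℂ C(Circle, ℂ) :=
    { toFun := D
      map_add' := fun μ ν => ContinuousLinearMap.ext fun f =>
        VectorMeasure.integral_add_vectorMeasure (integrable_continuousMap μ f)
          (integrable_continuousMap ν f)
      map_smul' := fun c μ => ContinuousLinearMap.ext fun f =>
        integral_smul_complexMeasure μ c f.continuous.stronglyMeasurable f.norm_coe_le_norm }
  have hinj : Function.Injective D' := by
    rw [← LinearMap.ker_eq_bot, LinearMap.ker_eq_bot']
    intro μ hμ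
    exact complexMeasure_eq_zero_of_integral μ fun f => DFunLike.congr_fun hμ f
  have hsurj (F : StrongDual ℂ C(Circle, ℂ)) :
      ∃ μ, D' μ = F ∧ totalVariationNorm μ ≤ ‖F‖ := by
    obtain ⟨μ, hle, hμ⟩ := exists_complexMeasure_of_dual F
    refine ⟨μ, ContinuousLinearMap.ext hμ, ?_⟩
    have := ENNReal.toReal_mono enorm_ne_top hle
    rwa [toReal_enorm] at this
  refine ⟨LinearEquiv.ofBijective D' ⟨hinj, fun F => (hsurj F).imp fun _ h => h.1⟩,
    fun μ f => rfl, fun μ => le_antisymm ?_ ?_⟩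
  · exact LinearMap.mkContinuous_norm_le _ ENNReal.toReal_nonneg (norm_cintegral_le μ)
  -- The Riesz measure of the functional of $\mu$ satisfies the norm bound, and by injectivity it is
  -- $\mu$ itself.
  · obtain ⟨ν, hν, hle⟩ := hsurj (D' μ)
    rw [hinj hν] at hle
    exact hle

theorem cintegral_mconv_circlePow (μ ν : ComplexMeasure Circle) (k : ℤ) :
    cintegral (mconv μ ν) (circlePow k) =
      cintegral μ (circlePow k) * cintegral ν (circlePow k) := by
  have hm : Measurable fun p : Circle × Circle => p.1 * p.2 := by fun_prop
  have hsm := (circlePow k).continuous.stronglyMeasurable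
  rw [cintegral, mconv, VectorMeasure.integral_map hm hsm.aestronglyMeasurable]
  · have : (fun p : Circle × Circle => circlePow k (p.1 * p.2)) =
        fun p => circlePow k p.1 * circlePow k p.2 := by
      ext p
      simp [circlePow, mul_zpow]
    rw [this]
    exact integral_prod_mul_complexMeasure μ ν hsm hsm (circlePow k).norm_coe_le_norm
      (circlePow k).norm_coe_le_norm
  · exact Integrable.of_bound (hsm.comp_measurable hm).aestronglyMeasurable ‖circlePow k‖
      (Eventually.of_forall fun p => (circlePow k).norm_coe_le_norm _)

/-! ### The product of the dual space and convolution -/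

theorem comul_Tmon (n m : ℕ) : comul (Tmon n m) = elemTensor (Tmon n m) (Tmon n m) := by
  have hmul (a b c d : toeplitz) : elemTensor (a * b) (c * d) =
      elemTensor a c * elemTensor b d := Subtype.ext (tensorOp_mul _ _ _ _)
  have hone : elemTensor (1 : toeplitz) (1 : toeplitz) = 1 := Subtype.ext tensorOp_one
  have hpow (a : toeplitz) (k : ℕ) : elemTensor (a ^ k) (a ^ k) = elemTensor a a ^ k := by
    induction k with
    | zero => simpa using hone
    | succ k ih => rw [pow_succ, hmul, ih, pow_succ]
  have hstar (a : toeplitz) : elemTensor (star a) (star a) = star (elemTensor a a) :=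
    Subtype.ext (tensorOp_star _ _).symm
  have h : Tmon n m = T ^ n * star T ^ m := rfl
  rw [h, map_mul, map_pow, map_pow, map_star, comul_T, hmul, hpow, hpow, hstar]

theorem dualMul_Tmon (ρ φ : StrongDual ℂ toeplitz) (n m : ℕ) :
    dualMul ρ φ (Tmon n m) = ρ (Tmon n m) * φ (Tmon n m) := by
  rw [dualMul_apply, comul_Tmon, tensorFunctional_apply]

/-- The dual of the quotient by the compact operators is their annihilator. -/
theorem exists_annihilator_equiv :
    ∃ π₁ : StrongDual ℂ (toeplitz ⧸ compacts) ≃ₗᵢ[ℂ] annihilator,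
      ∀ (φ : StrongDual ℂ (toeplitz ⧸ compacts)) (A : toeplitz),
        (π₁ φ : StrongDual ℂ toeplitz) A = φ (compacts.mkQ A) :=
  exists_dual_quotient_isometry compacts annihilator fun _ => Iff.rfl

theorem exists_measure_equiv (π₂ : (toeplitz ⧸ compacts) ≃ₗᵢ[ℂ] C(Circle, ℂ)) :
    ∃ γ : ComplexMeasure Circle ≃ₗ[ℂ] StrongDual ℂ (toeplitz ⧸ compacts),
      (∀ μ x, γ μ x = cintegral μ (π₂ x)) ∧ ∀ μ, ‖γ μ‖ = totalVariationNorm μ :=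
  Exists.elim exists_riesz_equiv fun R hR => Exists.elim (exists_dual_congr π₂) fun C hC =>
    ⟨R.trans C, fun μ x => (hC.1 (R μ) x).trans (hR.1 μ (π₂ x)),
      fun μ => (hC.2 (R μ)).trans (hR.2 μ)⟩

/-- The quotient by the subspace `compacts` is only a normed space here, so multiplicativity is
expressed on representatives. -/
theorem symbol_mul {π₂ : (toeplitz ⧸ compacts) ≃ₗᵢ[ℂ] C(Circle, ℂ)}
    (hπ₂ : ∀ n m : ℕ, π₂ (compacts.mkQ (Tmon n m)) = circlePow ((m : ℤ) - n)) (A B : toeplitz) :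
    π₂ (compacts.mkQ (A * B)) = π₂ (compacts.mkQ A) * π₂ (compacts.mkQ B) :=
  quotient_isometry_mul
    (p := (π₂.toContinuousLinearEquiv : (toeplitz ⧸ compacts) →L[ℂ] C(Circle, ℂ)) ∘L compacts.mkQL)
    hπ₂ A B

theorem symbol_star {π₂ : (toeplitz ⧸ compacts) ≃ₗᵢ[ℂ] C(Circle, ℂ)}
    (hπ₂ : ∀ n m : ℕ, π₂ (compacts.mkQ (Tmon n m)) = circlePow ((m : ℤ) - n)) (A : toeplitz) :
    π₂ (compacts.mkQ (star A)) = star (π₂ (compacts.mkQ A)) :=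
  quotient_isometry_star
    (p := (π₂.toContinuousLinearEquiv : (toeplitz ⧸ compacts) →L[ℂ] C(Circle, ℂ)) ∘L compacts.mkQL)
    hπ₂ A

/-- A functional represented by the convolution of two measures is the product of the functionals
represented by the factors. -/
theorem eq_dualMul_of_mconv {π₂ : (toeplitz ⧸ compacts) ≃ₗᵢ[ℂ] C(Circle, ℂ)}
    (hπ₂ : ∀ n m : ℕ, π₂ (compacts.mkQ (Tmon n m)) = circlePow ((m : ℤ) - n))
    {μ ν : ComplexMeasure Circle} {ρ φ ψ : StrongDual ℂ toeplitz}
    (hρ : ∀ A, ρ A = cintegral μ (π₂ (compacts.mkQ A)))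
    (hφ : ∀ A, φ A = cintegral ν (π₂ (compacts.mkQ A)))
    (hψ : ∀ A, ψ A = cintegral (mconv μ ν) (π₂ (compacts.mkQ A))) : ψ = dualMul ρ φ := by
  refine toeplitz_ext fun n m => ?_
  rw [dualMul_Tmon, hρ, hφ, hψ, hπ₂, cintegral_mconv_circlePow]

end ToeplitzQuantumSemigroup

end

open MeasureTheory ToeplitzQuantumSemigroup
theorem theorem9 :
    (∀ ρ ∈ annihilator, ∀ φ ∈ annihilator, dualMul ρ φ ∈ annihilator) ∧
    ∃ (π₁ : StrongDual ℂ (toeplitz ⧸ compacts) ≃ₗᵢ[ℂ] annihilator)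
      (π₂ : (toeplitz ⧸ compacts) ≃ₗᵢ[ℂ] C(Circle, ℂ))
      (γ : ComplexMeasure Circle ≃ₗ[ℂ] StrongDual ℂ (toeplitz ⧸ compacts)),
      (∀ (φ : StrongDual ℂ (toeplitz ⧸ compacts)) (A : toeplitz),
        (π₁ φ : StrongDual ℂ toeplitz) A = φ (compacts.mkQ A)) ∧
      (∀ A B : toeplitz, π₂ (compacts.mkQ (A * B)) = π₂ (compacts.mkQ A) * π₂ (compacts.mkQ B)) ∧
      (∀ A : toeplitz, π₂ (compacts.mkQ (star A)) = star (π₂ (compacts.mkQ A))) ∧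
      (∀ (n m : ℕ) (z : Circle),
        π₂ (compacts.mkQ (Tmon n m)) z = (z : ℂ) ^ ((m : ℤ) - (n : ℤ))) ∧
      (∀ μ x, γ μ x = cintegral μ (π₂ x)) ∧
      (∀ μ, ‖γ μ‖ = totalVariationNorm μ) ∧
      (∀ μ ν, (π₁ (γ (mconv μ ν)) : StrongDual ℂ toeplitz) = dualMul (π₁ (γ μ)) (π₁ (γ ν))) := by

  refine Exists.elim exists_annihilator_equiv fun π₁ hπ₁ => ?_
  refine Exists.elim exists_quotient_isometry fun π₂ hπ₂ => ?_
  refine Exists.elim (exists_measure_equiv π₂) fun γ hγ => ?_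
  have hΦ (μ : ComplexMeasure Circle) (A : toeplitz) :
      (π₁ (γ μ) : StrongDual ℂ toeplitz) A = cintegral μ (π₂ (compacts.mkQ A)) :=
    (hπ₁ (γ μ) A).trans (hγ.1 μ (compacts.mkQ A))
  have hconv (μ ν : ComplexMeasure Circle) : (π₁ (γ (mconv μ ν)) : StrongDual ℂ toeplitz) =
      dualMul (π₁ (γ μ)) (π₁ (γ ν)) :=
    eq_dualMul_of_mconv hπ₂ (hΦ μ) (hΦ ν) (hΦ (mconv μ ν))
  have hsurj (ρ : StrongDual ℂ toeplitz) (hρ : ρ ∈ annihilator) :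
      ∃ μ, (π₁ (γ μ) : StrongDual ℂ toeplitz) = ρ :=
    ⟨γ.symm (π₁.symm ⟨ρ, hρ⟩), congrArg Subtype.val
      ((congrArg π₁ (γ.apply_symm_apply _)).trans (π₁.apply_symm_apply ⟨ρ, hρ⟩))⟩
  refine ⟨fun ρ hρ φ hφ => ?_, π₁, π₂, γ, hπ₁, symbol_mul hπ₂, symbol_star hπ₂,
    fun n m z => ?_, hγ.1, hγ.2, hconv⟩
  -- Both factors come from measures, so their product is the functional of the convolution, which
  -- lies in the range of `π₁`.
  · obtain ⟨μ, rfl⟩ := hsurj ρ hρ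
    obtain ⟨ν, rfl⟩ := hsurj φ hφ
    exact hconv μ ν ▸ Subtype.mem _
  · exact (DFunLike.congr_fun (hπ₂ n m) z).trans (circlePow_apply _ _)
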